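/- **Setting.** Let $d\ge 0$, let $(\mu_x)_{x\in\mathbb R^d}$ be a measurable family of probability measures on $\mathbb R^d$, and let $x_0,x_T\in\mathbb R^d$, $T>0$. Put $$H(x,\alpha)=\ln\int e^{\alpha\cdot z}\mu_x(dz),\qquad L(x,\beta)=\sup_{\alpha}[\alpha\cdot\beta-H(x,\alpha)],$$ $I_{[0,T]}(\phi)=\int_0^T L(\phi,\dot\phi)\,dt$ if $\phi$ is absolutely continuous and $I_{[0,T]}(\phi)=\infty$ otherwise, and $S(x,T|y)=\inf\{I_{[0,T]}(\phi):\phi(0)=y,\ \phi(T)=x\}$. A path attaining the infimum in $S(x,T|y)$ with a finite value is called a non-stationary optimal path (NOP) from $y$ to $x$ in time $T$. For $\varepsilon>0$ let $x^\varepsilon$ be the right-continuous step process with $x^\varepsilon((n+1)\varepsilon)=x^\varepsilon(n\varepsilon)+\varepsilon Z_n$, constant on $[n\varepsilon,(n+1)\varepsilon)$, where $Z_n$ has law $\mu_{x}$ given $x^\varepsilon(n\varepsilon)=x$ and the past. Assume that for all small $\varepsilon$ the law of this walk after any number $n\ge1$ of steps from any point has a Lebesgue density, and let $p^\varepsilon(y,T|x,t)$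 denote the density of $x^\varepsilon(T)$ given $x^\varepsilon(t)=x$, that is, the density after $\lfloor T/\varepsilon\rfloor-\lfloor t/\varepsilon\rfloor\geq 1$ steps from $x$. Put $$\tilde\mu^\varepsilon_{x,t}(dz)=\frac{p^\varepsilon(x_T,T|x+\varepsilon z,t+\varepsilon)\,\mu_x(dz)}{p^\varepsilon(x_T,T|x,t)},\qquad \tilde b^\varepsilon(x,t)=\int z\,\tilde\mu^\varepsilon_{x,t}(dz)$$ (when only one step is left, $\tilde\mu^\varepsilon_{x,t}$ is the unit mass at $(x_T-x)/\varepsilon$). Let $\tilde x^{\varepsilon,\mathrm{NPPD}}(t)=\tilde x^{\varepsilon,\mathrm{NPPD}}(0)+\varepsilon\sum_{n=0}^{\lfloor t/\varepsilon\rfloor-1}\tilde Z_n^\varepsilon$, $t\in[0,T]$, with $\tilde x^{\varepsilon,\mathrm{NPPD}}(0)=x_0$ almost surely, where for $0\le n<\lfloor T/\varepsilon\rfloor$ the jump $\tilde Z^\varepsilon_n$ has law $\tilde\mu^\varepsilon_{x,n\varepsilon}$ given $\tilde x^{\varepsilon,\mathrm{NPPD}}(n\varepsilon)=x$ and the values at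 $k\varepsilon$, $k<n$. **Assumptions.** 1. There is a finite non-negative convex function $\bar H$ with $\bar H(0)=0$ and $H(x,\alpha)\le\bar H(\alpha)$ for all $x,\alpha$. $L$ is finite everywhere and $C^2$ in $\beta$, and for every $R>0$ there are $M_R,m_R>0$ with $L\le M_R$, $|\nabla_\beta L|\le M_R$ and $\sum_{i,j}\frac{\partial^2L}{\partial\beta_i\partial\beta_j}(x,\beta)\lambda_i\lambda_j\ge m_R|\lambda|^2$ for all $x,\lambda$ and all $|\beta|\le R$. As $\delta\to0$, $\sup_{|x-y|<\delta}\sup_\beta\frac{L(x,\beta)-L(y,\beta)}{1+L(y,\beta)}\to0$. 2. $H$ is $C^{k+1}$ in $(x,\alpha)$ for some integer $k\ge1$. $\phi_{\mathrm{NOP}}$ is a NOP from $x_0$ to $x_T$ in time $T$, and there are $\gamma_0>0$ and a NOP $\bar\phi$ on $[0,T+2\gamma_0]$ (connecting its own endpoints) with $\phi_{\mathrm{NOP}}(t)=\bar\phi(t+\gamma_0)$ for $t\in[0,T]$. 3. For $T^*\in(0,T)$ and $\delta_0>0$ write $\Sigma_{\delta_0,[0,T^*]}=\bigcup_{t\in[0,T^*]}B_{\delta_0}(\phi_{\mathrm{NOP}}(t))$.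 For every $T^*\in(0,T)$ there is $\delta_0>0$ such that $(x,t)\mapsto S(x_T,T-t|x)$ is $C^2$ on $\Sigma_{\delta_0,[0,T^*]}\times[0,T^*]$, and such that for all small $\varepsilon$: for all $t\in[0,T^*]$ and all $x$ the density $y\mapsto p^\varepsilon(y,T|x,t)$ is continuous and $p^\varepsilon(x_T,T|x,t)>0$; and, as $r\to0$, $P(x^\varepsilon(T)\in B_r(x_T)\,|\,x^\varepsilon(t)=x)/\lambda(B_r(x_T))\to p^\varepsilon(x_T,T|x,t)$ uniformly on $\Sigma_{\delta_0,[0,T^*]}\times[0,T^*]$, where $\lambda$ is Lebesgue measure. 4. For every $T^*\in(0,T)$ there is $\delta_0>0$ such that, with suprema and uniformity over $(x,t)\in\Sigma_{\delta_0,[0,T^*]}\times[0,T^*]$: (a) for some constant $G_3<\infty$ and all small $\varepsilon$, $\sup_{(x,t)}\int|z|\,\tilde\mu^\varepsilon_{x,t}(dz)\le G_3$; (b) as $\varepsilon\to0$, $\tilde b^\varepsilon(x,t)\to\tilde b(x,t):=\nabla_\alpha H\big(x,-\nabla_xS(x_T,T-t|x)\big)$ uniformly; (c) for some $\varkappa_2\in(0,1]$,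 some constant $G_4<\infty$ and all small $\varepsilon$, $\sup_{(x,t)}\int|z-\tilde b^\varepsilon(x,t)|^{1+\varkappa_2}\tilde\mu^\varepsilon_{x,t}(dz)\le G_4$. **Conclusion.** For every $T^*\in(0,T)$ there is $\delta_0>0$ such that for every $\delta\in(0,\delta_0)$ $$\lim_{\varepsilon\to0}P\Big(\sup_{t\in[0,T^*]}\big|\tilde x^{\varepsilon,\mathrm{NPPD}}(t)-\phi_{\mathrm{NOP}}(t)\big|>\delta\Big)=0 .$$ -/

import Mathlib

open MeasureTheory ProbabilityTheory Filter Topology Set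
open scoped ENNReal NNReal

namespace NPPD

/-- The state space `ℝ^d` with its Euclidean norm. -/
abbrev Rd (d : ℕ) : Type := EuclideanSpace ℝ (Fin d)

noncomputable section

variable {d : ℕ}

/-! ### Hamiltonian, Lagrangian, action, optimal paths -/

/-- `H(x,α) = ln ∫ exp(α·z) μ_x(dz)`, with values in `[-∞,∞]`. -/
def hamiltonian (μ : Kernel (Rd d) (Rd d)) (x α : Rd d) : EReal :=
  ENNReal.log (∫⁻ z, ENNReal.ofReal (Real.exp (inner ℝ α z)) ∂(μ x))

/-- `L(x,β) = sup_α [α·β - H(x,α)]`, with values in `[-∞,∞]`. -/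
def lagrangian (μ : Kernel (Rd d) (Rd d)) (x β : Rd d) : EReal :=
  ⨆ α : Rd d, ((inner ℝ α β : ℝ) : EReal) - hamiltonian μ x α

open Classical in
/-- The action `I_{[0,T]}(φ)`: the integral of `L(φ, φ')` over `[0,T]` if `φ` is absolutely
continuous on `[0,T]`, and `∞` otherwise (`L ≥ 0` whenever every `μ_x` is a probability). -/
def action (μ : Kernel (Rd d) (Rd d)) (T : ℝ) (φ : ℝ → Rd d) : ℝ≥0∞ :=
  if AbsolutelyContinuousOnInterval φ 0 T then
    ∫⁻ t in Icc 0 T, (lagrangian μ (φ t) (deriv φ t)).toENNReal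
  else ∞

/-- `quasiPotential μ x T x₀` is `S(x,T|x₀)`, the infimum of the action over the paths on `[0,T]`
from `x₀` to `x`. -/
def quasiPotential (μ : Kernel (Rd d) (Rd d)) (x : Rd d) (T : ℝ) (x₀ : Rd d) : ℝ≥0∞ :=
  ⨅ (φ : ℝ → Rd d) (_ : φ 0 = x₀) (_ : φ T = x), action μ T φ

/-- `φ` (restricted to `[0,T]`) is a non-stationary optimal path from `x₀` to `xT` in the
time span `T`. -/
structure IsNOP (μ : Kernel (Rd d) (Rd d)) (xT : Rd d) (T : ℝ) (x₀ : Rd d)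
    (φ : ℝ → Rd d) : Prop where
  start : φ 0 = x₀
  finish : φ T = xT
  minimal : action μ T φ = quasiPotential μ xT T x₀
  finite : action μ T φ < ∞

/-- The path on `[0,T]` is a proper subarc of an optimal path on a time interval that is longer
at both ends. -/
def IsProperSubarc (μ : Kernel (Rd d) (Rd d)) (T : ℝ) (φ : ℝ → Rd d) : Prop :=
  ∃ γ > 0, ∃ ψ : ℝ → Rd d, IsNOP μ (ψ (T + 2 * γ)) (T + 2 * γ) (ψ 0) ψ ∧
    ∀ t ∈ Icc 0 T, φ t = ψ (t + γ)

/-- The standing conditions on `H` and `L` under which the large deviation principle is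
formulated. -/
structure LDPConditions (μ : Kernel (Rd d) (Rd d)) : Prop where
  /-- `H(x,·)` is dominated, uniformly in `x`, by a finite nonnegative convex function vanishing
  at `0`. -/
  hamiltonian_le : ∃ Hbar : Rd d → ℝ, ConvexOn ℝ univ Hbar ∧ (∀ α, 0 ≤ Hbar α) ∧ Hbar 0 = 0 ∧
    ∀ x α, hamiltonian μ x α ≤ (Hbar α : EReal)
  /-- `L` is finite everywhere. -/
  lagrangian_lt_top : ∀ x β, lagrangian μ x β < ⊤
  /-- `L(x,·)` is twice differentiable, so that the derivatives in the bounds below make sense. -/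
  lagrangian_contDiff : ∀ x, ContDiff ℝ 2 (fun β => (lagrangian μ x β).toReal)
  /-- Local bounds on `L`, its gradient and its Hessian in `β`, uniform in `x`. -/
  lagrangian_bounds : ∀ R > 0, ∃ M > 0, ∃ m > 0, ∀ x β : Rd d, ‖β‖ ≤ R →
    (lagrangian μ x β).toReal ≤ M ∧
    ‖gradient (fun β => (lagrangian μ x β).toReal) β‖ ≤ M ∧
    ∀ v : Rd d, m * ‖v‖ ^ 2 ≤ fderiv ℝ (fderiv ℝ (fun β => (lagrangian μ x β).toReal)) β v v
  /-- The relative modulus of continuity of `L` in `x` tends to `0`. -/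
  lagrangian_modulus : Tendsto
    (fun δ : ℝ => ⨆ (x : Rd d) (y : Rd d) (_ : dist x y < δ) (β : Rd d),
      ((((lagrangian μ x β).toReal - (lagrangian μ y β).toReal)
        / (1 + (lagrangian μ y β).toReal) : ℝ) : EReal))
    (𝓝[>] 0) (𝓝 0)

/-- The tube `Σ_{δ₀,[0,T*]}`: the union over `t ∈ [0,T*]` of the open balls of radius `δ₀` around
`φ t`. -/
def tube (φ : ℝ → Rd d) (δ₀ Ts : ℝ) : Set (Rd d) :=
  ⋃ t ∈ Icc 0 Ts, Metric.ball (φ t) δ₀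

/-- The limiting drift `b̃(x,t) = ∇_α H(x, -∇_x S(xT, T-t | x))`. -/
def limitDrift (μ : Kernel (Rd d) (Rd d)) (xT : Rd d) (T : ℝ) (x : Rd d) (t : ℝ) : Rd d :=
  gradient (fun α => (hamiltonian μ x α).toReal)
    (-gradient (fun y => (quasiPotential μ xT (T - t) y).toReal) x)

/-! ### The random walk and its transition densities -/

/-- One step of the walk: from `x` to `x + ε z`, with `z` distributed according to `μ_x`. -/
def stepKernel (μ : Kernel (Rd d) (Rd d)) (ε : ℝ) : Kernel (Rd d) (Rd d) :=
  (Kernel.id ×ₖ μ).map (fun q => q.1 + ε • q.2)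

/-- The number `⌊T/ε⌋ - ⌊t/ε⌋` of steps that the walk makes in the time interval `(t,T]`. -/
def stepsLeft (T ε t : ℝ) : ℕ := ⌊T / ε⌋₊ - ⌊t / ε⌋₊

/-- The law of `x^ε(T)` given `x^ε(t) = x`. -/
def transitionLaw (μ : Kernel (Rd d) (Rd d)) (T ε t : ℝ) (x : Rd d) : Measure (Rd d) :=
  (stepKernel μ ε ^ stepsLeft T ε t) x

/-- `p n x y` is, as a function of `y`, a Lebesgue density of the law of the walk after `n ≥ 1`
steps from `x`. Hence the density `p^ε(y,T|x,t)` is `p (stepsLeft T ε t) x y`. -/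
structure IsTransitionDensity (μ : Kernel (Rd d) (Rd d)) (ε : ℝ)
    (p : ℕ → Rd d → Rd d → ℝ) : Prop where
  measurable : ∀ n, 1 ≤ n → Measurable (Function.uncurry (p n))
  nonneg : ∀ n, 1 ≤ n → ∀ x y, 0 ≤ p n x y
  density : ∀ n, 1 ≤ n → ∀ x,
    (stepKernel μ ε ^ n) x = volume.withDensity (fun y => ENNReal.ofReal (p n x y))

/-- The conditioned jump law
`μ̃_{x,t}(dz) = p(xT,T | x + εz, t + ε) μ_x(dz) / p(xT,T | x,t)`.
If only one step is left, `p(xT,T | ·, t + ε)` is the Dirac density at `xT` and the jump leads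
from `x` to `xT`. -/
def condJump (μ : Kernel (Rd d) (Rd d)) (p : ℕ → Rd d → Rd d → ℝ) (xT : Rd d) (T ε : ℝ)
    (x : Rd d) (t : ℝ) : Measure (Rd d) :=
  if stepsLeft T ε t ≤ 1 then Measure.dirac (ε⁻¹ • (xT - x))
  else (μ x).withDensity (fun z =>
    ENNReal.ofReal (p (stepsLeft T ε t - 1) (x + ε • z) xT / p (stepsLeft T ε t) x xT))

/-- The drift `b̃^ε(x,t) = ∫ z μ̃_{x,t}(dz)`. -/
def condDrift (μ : Kernel (Rd d) (Rd d)) (p : ℕ → Rd d → Rd d → ℝ) (xT : Rd d) (T ε : ℝ)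
    (x : Rd d) (t : ℝ) : Rd d :=
  ∫ z, z ∂(condJump μ p xT T ε x t)

/-- `X` is the right-continuous step process on `[0,T]` started at `x₀` with
`X(t) = X(0) + ε ∑_{n < ⌊t/ε⌋} Z_n`, where, conditionally on the history `X(0), X(ε), …, X(nε)`,
the jump `Z_n` has the law `ν (X(nε)) (nε)`. -/
structure IsJumpProcess {Ω : Type*} [MeasurableSpace Ω] (P : Measure Ω) (T ε : ℝ) (x₀ : Rd d)
    (ν : Rd d → ℝ → Measure (Rd d)) (X : ℝ → Ω → Rd d) (Z : ℕ → Ω → Rd d) : Prop where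
  measurable_init : Measurable (X 0)
  measurable_jump : ∀ n, Measurable (Z n)
  init : ∀ᵐ ω ∂P, X 0 ω = x₀
  path : ∀ t ∈ Icc 0 T, ∀ ω, X t ω = X 0 ω + ε • ∑ n ∈ Finset.range ⌊t / ε⌋₊, Z n ω
  jump_law : ∀ n < ⌊T / ε⌋₊, ∀ D : Set (Rd d), MeasurableSet D →
    P[(Z n ⁻¹' D).indicator (fun _ => (1 : ℝ)) |
        ⨆ k ∈ Finset.range (n + 1), MeasurableSpace.comap (X (k * ε)) inferInstance]
      =ᵐ[P] fun ω => (ν (X (n * ε) ω) (n * ε)).real D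

end

end NPPD

/-!
The limiting drift turns out to be the velocity of the optimal path, and the conditioned walk is a
small random perturbation of the differential equation of that drift.

*The path.* Write `V(x, t) = S(xT, T - t | x)`. Concatenating a short segment of velocity `β` with
almost optimal continuations gives `0 ≤ ∂ₜV + ∇ₓV · β + L(x, β)` wherever `V` is differentiable
(`LDPConditions.valueFun_deriv_ge`). Along the optimal path the remaining part of the path is
optimal too, so that `V(φ(t), t)` is the integral of the running cost over `[t, T]`, and Lebesgue's
differentiation theorem gives equality for `β = φ'(t)` at almost every `t`
(`IsNOP.ae_valueFun_deriv`). Hence `φ'(t)` competes with `∇_α H(φ, -∇ₓV)` in the maximization of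
`α · β - L(φ, β)` at `α = -∇ₓV`. The latter is a maximizer since `H` is convex, and maximizers are
unique since the Hessian of `L` is positive definite, so `φ' = b̃(φ, t)` almost everywhere
(`IsNOP.ae_deriv_eq_limitDrift`). As `b̃` is `C¹` near the graph of `φ`, it is Lipschitz there
(`exists_lipschitz_near_path`) and `φ` is uniformly differentiable with slope `b̃`
(`IsNOP.exists_norm_sub_limitDrift_le`).

*The walk.* The deviation `D` of the walk from `φ` on the time grid is controlled by the function
`f(D) = √(1 + ‖D‖²) - 1`. It is quadratic near `0` and grows linearly, so a jump `ε z` raises its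
mean by at most `O(ε^(1 + κ₂))` beyond the effect of the drift (`lintegral_softNorm_add_smul_le`),
and the drift multiplies it by at most `(1 + ε K)²` up to an error `o(ε)`. A Gronwall argument for
the process killed on leaving a small ball around the path then bounds the probability of leaving,
since `f` is bounded below outside of that ball (`mul_measure_compl_stayEvent_le`).
-/

namespace NPPD

/-! ### Convex duality between the Hamiltonian and the Lagrangian -/

section Duality

variable {d : ℕ} {μ : Kernel (Rd d) (Rd d)}

lemma hamiltonian_ne_bot [IsMarkovKernel μ] (x α : Rd d) : hamiltonian μ x α ≠ ⊥ := by
  rw [hamiltonian, Ne, ENNReal.log_eq_bot_iff, lintegral_eq_zero_iff (by fun_prop)]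
  intro h
  have : ∀ᵐ z ∂(μ x), False := by
    filter_upwards [h] with z hz
    simp only [Pi.zero_apply, ENNReal.ofReal_eq_zero] at hz
    exact absurd hz (not_le.2 (Real.exp_pos _))
  simp at this
  exact IsProbabilityMeasure.ne_zero (μ x) this

lemma hamiltonian_zero [IsMarkovKernel μ] (x : Rd d) : hamiltonian μ x 0 = 0 := by
  simp [hamiltonian]

lemma LDPConditions.hamiltonian_ne_top (h : LDPConditions μ) (x α : Rd d) :
    hamiltonian μ x α ≠ ⊤ := by
  obtain ⟨Hbar, -, -, -, hle⟩ := h.hamiltonian_le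
  exact ne_top_of_le_ne_top (EReal.coe_ne_top _) (hle x α)

lemma LDPConditions.coe_hamiltonian [IsMarkovKernel μ] (h : LDPConditions μ) (x α : Rd d) :
    ((hamiltonian μ x α).toReal : EReal) = hamiltonian μ x α :=
  EReal.coe_toReal (h.hamiltonian_ne_top x α) (hamiltonian_ne_bot x α)

lemma lagrangian_nonneg [IsMarkovKernel μ] (x β : Rd d) : 0 ≤ lagrangian μ x β := by
  refine le_trans ?_ (le_iSup _ (0 : Rd d))
  simp [hamiltonian_zero]

lemma LDPConditions.coe_lagrangian [IsMarkovKernel μ] (h : LDPConditions μ) (x β : Rd d) :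
    ((lagrangian μ x β).toReal : EReal) = lagrangian μ x β :=
  EReal.coe_toReal (h.lagrangian_lt_top x β).ne
    (ne_of_gt (lt_of_lt_of_le EReal.bot_lt_zero (lagrangian_nonneg x β)))

lemma lagrangian_toReal_nonneg [IsMarkovKernel μ] (x β : Rd d) :
    0 ≤ (lagrangian μ x β).toReal :=
  EReal.toReal_nonneg (lagrangian_nonneg x β)

lemma LDPConditions.inner_sub_hamiltonian_le [IsMarkovKernel μ] (h : LDPConditions μ)
    (x α β : Rd d) :
    inner ℝ α β - (hamiltonian μ x α).toReal ≤ (lagrangian μ x β).toReal := by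
  have h1 : ((inner ℝ α β : ℝ) : EReal) - hamiltonian μ x α ≤ lagrangian μ x β :=
    le_iSup (fun α : Rd d => ((inner ℝ α β : ℝ) : EReal) - hamiltonian μ x α) α
  rw [← h.coe_hamiltonian, ← h.coe_lagrangian, ← EReal.coe_sub] at h1
  exact_mod_cast h1

/-- The Hamiltonian is convex in the momentum: this is Hölder's inequality for exponentials. -/
lemma LDPConditions.convexOn_hamiltonian [IsMarkovKernel μ] (h : LDPConditions μ) (x : Rd d) :
    ConvexOn ℝ univ (fun α => (hamiltonian μ x α).toReal) := by
  refine ⟨convex_univ, fun α _ α' _ a b ha hb hab => ?_⟩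
  have key : hamiltonian μ x (a • α + b • α') ≤
      (a : EReal) * hamiltonian μ x α + (b : EReal) * hamiltonian μ x α' := by
    unfold hamiltonian
    rw [← ENNReal.log_rpow, ← ENNReal.log_rpow, ← ENNReal.log_mul_add]
    refine ENNReal.log_monotone ?_
    refine le_trans (le_of_eq ?_) (ENNReal.lintegral_mul_norm_pow_le (by fun_prop) (by fun_prop)
      ha hb hab)
    refine lintegral_congr fun z => ?_
    rw [ENNReal.ofReal_rpow_of_pos (Real.exp_pos _), ENNReal.ofReal_rpow_of_pos (Real.exp_pos _),
      ← ENNReal.ofReal_mul (by positivity), ← Real.exp_mul, ← Real.exp_mul, ← Real.exp_add]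
    congr 2
    rw [inner_add_left, inner_smul_left, inner_smul_left]
    simp [mul_comm]
  rw [← h.coe_hamiltonian x (a • α + b • α'), ← h.coe_hamiltonian x α,
    ← h.coe_hamiltonian x α'] at key
  simp only [smul_eq_mul]
  exact_mod_cast key

/-- The supremum defining `L(x, ∇_α H(x, α))` is attained at `α`. -/
lemma LDPConditions.lagrangian_gradient [IsMarkovKernel μ] (h : LDPConditions μ) (x α : Rd d)
    (hd : DifferentiableAt ℝ (fun α => (hamiltonian μ x α).toReal) α) :
    (lagrangian μ x (gradient (fun α => (hamiltonian μ x α).toReal) α)).toReal =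
      inner ℝ α (gradient (fun α => (hamiltonian μ x α).toReal) α) -
        (hamiltonian μ x α).toReal := by
  set β := gradient (fun α => (hamiltonian μ x α).toReal) α with hβ
  refine le_antisymm ?_ (h.inner_sub_hamiltonian_le x α β)
  rw [← EReal.coe_le_coe_iff, h.coe_lagrangian]
  refine iSup_le fun α' => ?_
  rw [← h.coe_hamiltonian, ← EReal.coe_sub, EReal.coe_le_coe_iff]
  have hline : HasDerivAt (fun s : ℝ => (hamiltonian μ x (α + s • (α' - α))).toReal)
      (inner ℝ β (α' - α)) 0 := by
    have h1 : HasFDerivAt (fun α => (hamiltonian μ x α).toReal)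
        (InnerProductSpace.toDual ℝ (Rd d) β) (α + (0 : ℝ) • (α' - α)) := by
      rw [zero_smul, add_zero]
      exact hd.hasGradientAt.hasFDerivAt
    have h2 : HasDerivAt (fun s : ℝ => α + s • (α' - α)) (α' - α) 0 := by
      simpa using ((hasDerivAt_id (0 : ℝ)).smul_const (α' - α)).const_add α
    exact h1.comp_hasDerivAt (0 : ℝ) h2
  have hconv : ConvexOn ℝ univ (fun s : ℝ => (hamiltonian μ x (α + s • (α' - α))).toReal) := by
    have := (h.convexOn_hamiltonian x).comp_affineMap (AffineMap.lineMap α α' : ℝ →ᵃ[ℝ] Rd d)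
    simp only [preimage_univ] at this
    refine this.congr fun s _ => ?_
    simp [AffineMap.lineMap_apply, add_comm]
  have := hconv.le_slope_of_hasDerivAt (mem_univ 0) (mem_univ 1) one_pos hline
  simp only [slope, vsub_eq_sub, one_smul, zero_smul, add_zero, sub_zero, inv_one,
    add_sub_cancel] at this
  rw [inner_sub_right, real_inner_comm α' β, real_inner_comm α β] at this
  linarith

/-- Two velocities at which the linear functional `α · β - L(x, β)` is maximal coincide, because
the Hessian of `L(x, ·)` is positive definite. -/
lemma LDPConditions.eq_of_isMinOn [IsMarkovKernel μ] (h : LDPConditions μ) (x α β β' : Rd d)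
    (hβ : ∀ v, (lagrangian μ x β).toReal - inner ℝ α β ≤
      (lagrangian μ x v).toReal - inner ℝ α v)
    (hβ' : ∀ v, (lagrangian μ x β').toReal - inner ℝ α β' ≤
      (lagrangian μ x v).toReal - inner ℝ α v) : β = β' := by
  set f : Rd d → ℝ := fun v => (lagrangian μ x v).toReal with hf
  have hf2 : ContDiff ℝ 2 f := h.lagrangian_contDiff x
  have hfd : Differentiable ℝ f := hf2.differentiable (by norm_num)
  have hfd2 : Differentiable ℝ (fderiv ℝ f) :=
    (hf2.fderiv_right (m := 1) (by norm_num)).differentiable (by norm_num)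
  have hcrit : ∀ w, (∀ v, f w - inner ℝ α w ≤ f v - inner ℝ α v) →
      fderiv ℝ f w = innerSL ℝ α := by
    intro w hw
    have hmin : IsLocalMin (fun v => f v - innerSL ℝ α v) w :=
      Filter.Eventually.of_forall hw
    have := hmin.hasFDerivAt_eq_zero ((hfd w).hasFDerivAt.sub (innerSL ℝ α).hasFDerivAt)
    exact sub_eq_zero.1 this
  by_contra hne
  set v := β' - β with hv
  have hder : ∀ s : ℝ, HasDerivAt (fun s : ℝ => fderiv ℝ f (β + s • v) v)
      (fderiv ℝ (fderiv ℝ f) (β + s • v) v v) s := by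
    intro s
    have h2 : HasDerivAt (fun s : ℝ => β + s • v) v s := by
      simpa using ((hasDerivAt_id s).smul_const v).const_add β
    have h3 := (hfd2 (β + s • v)).hasFDerivAt.comp_hasDerivAt s h2
    simpa using h3.clm_apply (hasDerivAt_const s v)
  -- both gradients equal `α`, so by Rolle the Hessian vanishes in direction `v` somewhere between
  obtain ⟨s, hs, hs0⟩ := exists_hasDerivAt_eq_zero (f := fun s : ℝ => fderiv ℝ f (β + s • v) v)
    zero_lt_one (fun s _ => (hder s).continuousAt.continuousWithinAt)
    (by simp only [zero_smul, add_zero, one_smul]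
        rw [hcrit β hβ, hv, add_sub_cancel, hcrit β' hβ']) (fun s _ => hder s)
  obtain ⟨M, -, m, hm, hb⟩ := h.lagrangian_bounds (‖β + s • v‖ + 1) (by positivity)
  have h1 := (hb x (β + s • v) (by linarith)).2.2 v
  have h2 : 0 < ‖v‖ := norm_pos_iff.2 (sub_ne_zero.2 (Ne.symm hne))
  have h3 : 0 < m * ‖v‖ ^ 2 := by positivity
  exact absurd hs0 (by have := lt_of_lt_of_le h3 h1; exact ne_of_gt this)

/-- If `β` does at least as well as `∇_α H(x, α)` in the variational problem `max α · β - L(x, β)`,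
then the two are equal. -/
lemma LDPConditions.eq_gradient_hamiltonian [IsMarkovKernel μ] (h : LDPConditions μ)
    (x α β : Rd d) (hd : DifferentiableAt ℝ (fun α => (hamiltonian μ x α).toReal) α)
    (hβ : (lagrangian μ x β).toReal - inner ℝ α β ≤
      (lagrangian μ x (gradient (fun α => (hamiltonian μ x α).toReal) α)).toReal -
        inner ℝ α (gradient (fun α => (hamiltonian μ x α).toReal) α)) :
    β = gradient (fun α => (hamiltonian μ x α).toReal) α := by
  have h0 := h.lagrangian_gradient x α hd
  refine h.eq_of_isMinOn x α _ _ (fun v => ?_) (fun v => ?_)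
  · have := h.inner_sub_hamiltonian_le x α v
    linarith
  · have := h.inner_sub_hamiltonian_le x α v
    linarith

end Duality

/-! ### Absolutely continuous paths and the dynamic programming principle -/

/-- Absolute continuity is preserved by a nonexpansive monotone change of parameter. -/
lemma _root_.AbsolutelyContinuousOnInterval.comp_monotone {E : Type*} [PseudoMetricSpace E]
    {f : ℝ → E} {a b c d : ℝ} (hf : AbsolutelyContinuousOnInterval f a b) {g : ℝ → ℝ}
    (hg : Monotone g) (hg' : ∀ x y, dist (g x) (g y) ≤ dist x y)
    (hmaps : MapsTo g (uIcc c d) (uIcc a b)) :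
    AbsolutelyContinuousOnInterval (f ∘ g) c d := by
  rw [absolutelyContinuousOnInterval_iff] at hf ⊢
  intro ε hε
  obtain ⟨δ, hδ, h⟩ := hf ε hε
  refine ⟨δ, hδ, fun E hE hlen => ?_⟩
  refine h (E.1, fun i => (g (E.2 i).1, g (E.2 i).2)) ⟨?_, ?_⟩ ?_
  · intro i hi
    exact ⟨hmaps (hE.1 i hi).1, hmaps (hE.1 i hi).2⟩
  · intro i hi j hj hij
    have hd := hE.2 hi hj hij
    simp only [Function.onFun, uIoc, Ioc_disjoint_Ioc] at hd ⊢
    -- disjointness of half-open intervals is an inequality between a minimum and a maximum of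
    -- endpoints, and a monotone map preserves it
    rw [← hg.map_min, ← hg.map_max, ← hg.map_min, ← hg.map_max, ← hg.map_max, ← hg.map_min]
    exact hg hd
  · exact lt_of_le_of_lt (Finset.sum_le_sum fun i _ => hg' _ _) hlen

section Paths

variable {d : ℕ} {μ : Kernel (Rd d) (Rd d)}

/-- The path that follows `φ` on `[0,s]` and then `ψ`, started at time `s`. It is written as a sum
of two stopped paths, which makes its absolute continuity immediate; it is the concatenation only
if `φ s = ψ 0`. -/
def concat (s : ℝ) (φ ψ : ℝ → Rd d) : ℝ → Rd d := fun u =>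
  φ (min u s) + (ψ (max (u - s) 0) - ψ 0)

lemma absolutelyContinuousOnInterval_concat {s t : ℝ} (hs : 0 ≤ s) (ht : 0 ≤ t)
    {φ ψ : ℝ → Rd d} (hφ : AbsolutelyContinuousOnInterval φ 0 s)
    (hψ : AbsolutelyContinuousOnInterval ψ 0 t) :
    AbsolutelyContinuousOnInterval (concat s φ ψ) 0 (s + t) := by
  have h1 : AbsolutelyContinuousOnInterval (φ ∘ fun u => min u s) 0 (s + t) := by
    refine hφ.comp_monotone (fun x y h => min_le_min_right s h) (fun x y => ?_) (fun u hu => ?_)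
    · simpa [Real.dist_eq] using abs_min_sub_min_le_max x s y s
    · rw [uIcc_of_le (by linarith)] at hu
      rw [uIcc_of_le hs]
      exact ⟨le_min hu.1 hs, min_le_right _ _⟩
  have h2 : AbsolutelyContinuousOnInterval (ψ ∘ fun u => max (u - s) 0) 0 (s + t) := by
    refine hψ.comp_monotone (fun x y h => max_le_max_right 0 (by linarith)) (fun x y => ?_)
      (fun u hu => ?_)
    · simpa [Real.dist_eq] using abs_max_sub_max_le_max (x - s) 0 (y - s) 0
    · rw [uIcc_of_le (by linarith)] at hu
      rw [uIcc_of_le ht]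
      exact ⟨le_max_right _ _, max_le (by linarith [hu.2]) ht⟩
  have h3 : AbsolutelyContinuousOnInterval (fun _ : ℝ => ψ 0) 0 (s + t) :=
    (LipschitzWith.const (ψ 0)).lipschitzOnWith.absolutelyContinuousOnInterval
  exact h1.add (h2.sub h3)

lemma setLIntegral_Icc_add {s t : ℝ} (hs : 0 ≤ s) (ht : 0 ≤ t) (f : ℝ → ℝ≥0∞) :
    ∫⁻ u in Icc 0 (s + t), f u = (∫⁻ u in Icc 0 s, f u) + ∫⁻ u in Icc 0 t, f (u + s) := by
  have h1 : Icc 0 (s + t) = Icc 0 s ∪ Ioc s (s + t) :=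
    (Icc_union_Ioc_eq_Icc hs (by linarith)).symm
  rw [h1, lintegral_union measurableSet_Ioc]
  · congr 1
    have h2 := (measurePreserving_add_right (volume : Measure ℝ) s).setLIntegral_comp_preimage_emb
      (measurableEmbedding_addRight s) f (Icc s (s + t))
    rw [setLIntegral_congr Ioc_ae_eq_Icc, ← h2]
    simp
  · rw [Set.disjoint_left]
    exact fun u hu hu' => absurd hu.2 (not_le.2 hu'.1)

lemma action_of_absolutelyContinuous {T : ℝ} {φ : ℝ → Rd d}
    (h : AbsolutelyContinuousOnInterval φ 0 T) :
    action μ T φ = ∫⁻ t in Icc 0 T, (lagrangian μ (φ t) (deriv φ t)).toENNReal := if_pos h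

lemma absolutelyContinuous_of_action {T : ℝ} {φ : ℝ → Rd d} (h : action μ T φ < ∞) :
    AbsolutelyContinuousOnInterval φ 0 T := by
  by_contra hc
  simp [action, hc] at h

lemma absolutelyContinuousOnInterval_shift {s t : ℝ} (hs : 0 ≤ s) (ht : 0 ≤ t) {φ : ℝ → Rd d}
    (h : AbsolutelyContinuousOnInterval φ 0 (s + t)) :
    AbsolutelyContinuousOnInterval (fun u => φ (u + s)) 0 t := by
  refine h.comp_monotone (g := fun u => u + s) (fun x y h => by simpa using h)
    (fun x y => by simp) (fun u hu => ?_)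
  rw [uIcc_of_le ht] at hu
  rw [uIcc_of_le (by linarith)]
  exact ⟨by linarith [hu.1], by linarith [hu.2]⟩

/-- Additivity of the action over consecutive time intervals. -/
lemma action_add {s t : ℝ} (hs : 0 ≤ s) (ht : 0 ≤ t) {φ : ℝ → Rd d}
    (h : AbsolutelyContinuousOnInterval φ 0 (s + t)) :
    action μ (s + t) φ = action μ s φ + action μ t (fun u => φ (u + s)) := by
  have h1 : AbsolutelyContinuousOnInterval φ 0 s := h.mono (by
    rw [uIcc_of_le hs, uIcc_of_le (by linarith)]
    exact Icc_subset_Icc_right (by linarith))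
  rw [action_of_absolutelyContinuous h, action_of_absolutelyContinuous h1,
    action_of_absolutelyContinuous (absolutelyContinuousOnInterval_shift hs ht h),
    setLIntegral_Icc_add hs ht]
  simp only [deriv_comp_add_const]

/-- The action depends only on the values of the path on the interval. -/
lemma action_congr {T : ℝ} {φ ψ : ℝ → Rd d} (hT : 0 ≤ T) (h : EqOn φ ψ (Icc 0 T))
    (hφ : AbsolutelyContinuousOnInterval φ 0 T) : action μ T ψ = action μ T φ := by
  have hψ : AbsolutelyContinuousOnInterval ψ 0 T := by
    rw [absolutelyContinuousOnInterval_iff] at hφ ⊢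
    intro ε hε
    obtain ⟨δ, hδ, h'⟩ := hφ ε hε
    refine ⟨δ, hδ, fun E hE hlen => lt_of_le_of_lt (le_of_eq ?_) (h' E hE hlen)⟩
    refine Finset.sum_congr rfl fun i hi => ?_
    have := hE.1 i hi
    rw [uIcc_of_le hT] at this
    rw [h this.1, h this.2]
  rw [action_of_absolutelyContinuous hφ, action_of_absolutelyContinuous hψ,
    setLIntegral_congr Ioo_ae_eq_Icc.symm, setLIntegral_congr Ioo_ae_eq_Icc.symm]
  refine setLIntegral_congr_fun measurableSet_Ioo fun u hu => ?_
  have h1 : φ =ᶠ[𝓝 u] ψ := by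
    filter_upwards [Ioo_mem_nhds hu.1 hu.2] with w hw using h (Ioo_subset_Icc_self hw)
  simp only [h1.eq_of_nhds, h1.deriv_eq]

lemma action_concat {s t : ℝ} (hs : 0 ≤ s) (ht : 0 ≤ t) {φ ψ : ℝ → Rd d} (hst : φ s = ψ 0)
    (hφ : AbsolutelyContinuousOnInterval φ 0 s) (hψ : AbsolutelyContinuousOnInterval ψ 0 t) :
    action μ (s + t) (concat s φ ψ) = action μ s φ + action μ t ψ := by
  rw [action_add hs ht (absolutelyContinuousOnInterval_concat hs ht hφ hψ),
    action_congr hs (φ := φ) _ hφ, action_congr ht (φ := ψ) _ hψ]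
  · intro u hu
    simp [concat, hu.1, hst]
  · intro u hu
    simp [concat, hu.2]

/-- Dynamic programming inequality. -/
lemma quasiPotential_add_le {s t : ℝ} (hs : 0 ≤ s) (ht : 0 ≤ t) (z : Rd d) (φ : ℝ → Rd d) :
    quasiPotential μ z (s + t) (φ 0) ≤ action μ s φ + quasiPotential μ z t (φ s) := by
  rcases eq_or_ne (action μ s φ) ∞ with h | h
  · simp [h]
  have hφ := absolutelyContinuous_of_action (lt_top_iff_ne_top.2 h)
  conv_rhs => rw [quasiPotential]
  simp only [ENNReal.add_iInf]
  refine le_iInf fun ψ => le_iInf fun h0 => le_iInf fun ht' => ?_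
  rcases eq_or_ne (action μ t ψ) ∞ with h' | h'
  · simp [h']
  have hψ := absolutelyContinuous_of_action (lt_top_iff_ne_top.2 h')
  rw [← action_concat hs ht h0.symm hφ hψ]
  refine iInf_le_of_le (concat s φ ψ) (iInf_le_of_le ?_ (iInf_le_of_le ?_ le_rfl))
  · simp [concat, hs]
  · simp [concat, ht, ht', h0]

/-- Principle of optimality: the final part of an optimal path is optimal. -/
lemma IsNOP.action_shift {xT x₀ : Rd d} {T : ℝ} {φ : ℝ → Rd d} (hφ : IsNOP μ xT T x₀ φ)
    {s : ℝ} (hs : 0 ≤ s) (hsT : s ≤ T) :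
    action μ (T - s) (fun u => φ (u + s)) = quasiPotential μ xT (T - s) (φ s) := by
  have ht : 0 ≤ T - s := sub_nonneg.2 hsT
  have hAC := absolutelyContinuous_of_action hφ.finite
  have hT : s + (T - s) = T := by ring
  have h1 := action_add (μ := μ) hs ht (hT.symm ▸ hAC)
  rw [hT] at h1
  refine le_antisymm ?_ ?_
  · have h2 := quasiPotential_add_le (μ := μ) hs ht xT φ
    rw [hT, hφ.start, ← hφ.minimal, h1] at h2
    refine (ENNReal.add_le_add_iff_left ?_).1 h2
    have := hφ.finite
    rw [h1] at this
    exact (ENNReal.add_lt_top.1 this).1.ne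
  · refine iInf_le_of_le _ (iInf_le_of_le ?_ (iInf_le_of_le ?_ le_rfl))
    · simp
    · simp [hφ.finish]

/-- The action of a segment traversed with constant velocity. -/
lemma action_segment (x β : Rd d) (h : ℝ) :
    action μ h (fun s => x + s • β) =
      ∫⁻ s in Icc 0 h, (lagrangian μ (x + s • β) β).toENNReal := by
  have hd : ∀ s : ℝ, HasDerivAt (fun s : ℝ => x + s • β) β s := fun s => by
    simpa using ((hasDerivAt_id s).smul_const β).const_add x
  rw [action_of_absolutelyContinuous]
  · simp only [(hd _).deriv]
  · exact ContDiffOn.absolutelyContinuousOnInterval (by fun_prop)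

lemma action_segment_le [IsMarkovKernel μ] (hL : LDPConditions μ) (x β : Rd d) {h C : ℝ}
    (hh : 0 ≤ h) (hC : ∀ s ∈ Icc 0 h, (lagrangian μ (x + s • β) β).toReal ≤ C) :
    action μ h (fun s => x + s • β) ≤ ENNReal.ofReal (h * C) := by
  rw [action_segment x β h]
  calc ∫⁻ s in Icc 0 h, (lagrangian μ (x + s • β) β).toENNReal
      ≤ ∫⁻ s in Icc 0 h, ENNReal.ofReal C := by
        refine setLIntegral_mono' measurableSet_Icc fun s hs => ?_
        rw [← hL.coe_lagrangian, EReal.toENNReal_of_ne_top (EReal.coe_ne_top _)]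
        exact ENNReal.ofReal_le_ofReal (hC s hs)
    _ = ENNReal.ofReal (h * C) := by
        rw [setLIntegral_const, Real.volume_Icc, sub_zero, mul_comm, ENNReal.ofReal_mul hh]

/-- The action of the segment from `y` to `xT` bounds `S(xT, t | y)`. -/
lemma LDPConditions.quasiPotential_lt_top [IsMarkovKernel μ] (hL : LDPConditions μ)
    (xT y : Rd d) {t : ℝ} (ht : 0 < t) : quasiPotential μ xT t y < ∞ := by
  set β := t⁻¹ • (xT - y) with hβ
  obtain ⟨M, -, m, -, hb⟩ := hL.lagrangian_bounds (‖β‖ + 1) (by positivity)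
  refine lt_of_le_of_lt ?_ (lt_of_le_of_lt (action_segment_le hL y β ht.le (C := M)
    fun s _ => (hb _ _ (by linarith)).1) ENNReal.ofReal_lt_top)
  refine iInf_le_of_le _ (iInf_le_of_le ?_ (iInf_le_of_le ?_ le_rfl))
  · simp
  · simp [hβ, smul_smul, ht.ne']

/-- The uniform modulus of continuity of `L` in the space variable, as a one-sided estimate. -/
lemma LDPConditions.exists_lagrangian_le [IsMarkovKernel μ] (hL : LDPConditions μ) {η : ℝ}
    (hη : 0 < η) : ∃ δ > 0, ∀ x y β : Rd d, dist x y < δ →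
      (lagrangian μ x β).toReal ≤
        (lagrangian μ y β).toReal + η * (1 + (lagrangian μ y β).toReal) := by
  have h1 := hL.lagrangian_modulus.eventually_lt_const
    (show (0 : EReal) < (η : EReal) by exact_mod_cast hη)
  obtain ⟨δ, hδ, hlt⟩ := (h1.and self_mem_nhdsWithin).exists
  refine ⟨δ, hlt, fun x y β hxy => ?_⟩
  have h2 : ((((lagrangian μ x β).toReal - (lagrangian μ y β).toReal)
        / (1 + (lagrangian μ y β).toReal) : ℝ) : EReal) ≤ (η : EReal) :=
    le_trans (le_iSup_of_le x (le_iSup_of_le y (le_iSup_of_le hxy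
      (le_iSup (fun β : Rd d => ((((lagrangian μ x β).toReal - (lagrangian μ y β).toReal)
        / (1 + (lagrangian μ y β).toReal) : ℝ) : EReal)) β)))) hδ.le
  rw [EReal.coe_le_coe_iff, div_le_iff₀
    (by linarith [lagrangian_toReal_nonneg (μ := μ) y β])] at h2
  linarith

end Paths

/-! ### The Hamilton–Jacobi equation and the velocity of the optimal path -/

section HamiltonJacobi

variable {d : ℕ} {μ : Kernel (Rd d) (Rd d)}

/-- The value function `(x, t) ↦ S(xT, T - t | x)`. -/
noncomputable def valueFun (μ : Kernel (Rd d) (Rd d)) (xT : Rd d) (T : ℝ) (q : Rd d × ℝ) : ℝ :=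
  (quasiPotential μ xT (T - q.2) q.1).toReal

/-- One half of the Hamilton–Jacobi equation: along any velocity the value function decreases at a
rate at most `L`. -/
lemma LDPConditions.valueFun_deriv_ge [IsMarkovKernel μ] (hL : LDPConditions μ) {xT : Rd d}
    {T t : ℝ} (ht : t < T) {x : Rd d} {V' : Rd d × ℝ →L[ℝ] ℝ}
    (hV : HasFDerivAt (valueFun μ xT T) V' (x, t)) (β : Rd d) :
    0 ≤ V' (β, 1) + (lagrangian μ x β).toReal := by
  set ℓ := (lagrangian μ x β).toReal with hℓ
  have hℓ0 : 0 ≤ ℓ := lagrangian_toReal_nonneg x β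
  have hline : HasDerivAt (fun h : ℝ => valueFun μ xT T (x + h • β, t + h)) (V' (β, 1)) 0 := by
    have h1 : HasDerivAt (fun h : ℝ => (x + h • β, t + h)) (β, (1 : ℝ)) 0 := by
      refine HasDerivAt.prodMk ?_ ((hasDerivAt_id (0 : ℝ)).const_add t)
      simpa using ((hasDerivAt_id (0 : ℝ)).smul_const β).const_add x
    have h2 : HasFDerivAt (valueFun μ xT T) V' (x + (0 : ℝ) • β, t + 0) := by simpa using hV
    exact h2.comp_hasDerivAt (0 : ℝ) h1
  have hslope := (hasDerivAt_iff_tendsto_slope_zero.1 hline).mono_left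
    (nhdsWithin_mono (0 : ℝ) (fun h (hh : h ∈ Ioi (0 : ℝ)) => ne_of_gt hh))
  -- a short segment of velocity `β` costs at most `ℓ + η (1 + ℓ)` per unit of time, by the
  -- modulus of continuity of `L`
  have key : ∀ η > 0, -(ℓ + η * (1 + ℓ)) ≤ V' (β, 1) := by
    intro η hη
    obtain ⟨δ, hδ, hmod⟩ := hL.exists_lagrangian_le hη
    refine ge_of_tendsto hslope ?_
    have h1 : ∀ᶠ h in 𝓝[>] (0 : ℝ), h * ‖β‖ < δ := by
      have : Tendsto (fun h : ℝ => h * ‖β‖) (𝓝[>] 0) (𝓝 (0 * ‖β‖)) :=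
        (tendsto_nhdsWithin_of_tendsto_nhds tendsto_id).mul_const _
      rw [zero_mul] at this
      exact this.eventually_lt_const hδ
    have h2 : ∀ᶠ h in 𝓝[>] (0 : ℝ), h < T - t :=
      (tendsto_nhdsWithin_of_tendsto_nhds tendsto_id).eventually_lt_const (sub_pos.2 ht)
    filter_upwards [h1, h2, self_mem_nhdsWithin] with h hh1 hh2 (hh0 : 0 < h)
    have hseg := action_segment_le hL x β hh0.le (C := ℓ + η * (1 + ℓ)) (fun s hs => by
      refine hmod (x + s • β) x β ?_
      rw [dist_eq_norm, add_sub_cancel_left, norm_smul, Real.norm_eq_abs, abs_of_nonneg hs.1]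
      exact lt_of_le_of_lt (mul_le_mul_of_nonneg_right hs.2 (norm_nonneg _)) hh1)
    have hdp := quasiPotential_add_le (μ := μ) hh0.le (sub_nonneg.2 hh2.le) xT
      (fun s => x + s • β)
    have e1 : h + (T - t - h) = T - t := by ring
    have e2 : T - t - h = T - (t + h) := by ring
    simp only [zero_smul, add_zero, e1] at hdp
    rw [e2] at hdp
    have hle : valueFun μ xT T (x, t) ≤
        h * (ℓ + η * (1 + ℓ)) + valueFun μ xT T (x + h • β, t + h) := by
      have hfin : quasiPotential μ xT (T - (t + h)) (x + h • β) ≠ ∞ :=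
        (hL.quasiPotential_lt_top _ _ (by linarith)).ne
      have := ENNReal.toReal_mono (ENNReal.add_ne_top.2 ⟨ENNReal.ofReal_ne_top, hfin⟩)
        (hdp.trans (add_le_add_left hseg _))
      rw [ENNReal.toReal_add ENNReal.ofReal_ne_top hfin,
        ENNReal.toReal_ofReal (by positivity)] at this
      exact this
    simp only [zero_add, zero_smul, add_zero, smul_eq_mul]
    rw [inv_mul_eq_div, le_div_iff₀ hh0]
    nlinarith
  have : -(V' (β, 1) + ℓ) ≤ 0 := by
    refine le_of_forall_pos_le_add fun ε hε => ?_
    have := key (ε / (1 + ℓ)) (by positivity)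
    rw [div_mul_cancel₀ _ (by positivity)] at this
    linarith
  linarith

/-- The Lagrangian is lower semicontinuous, being a supremum of continuous functions. -/
lemma LDPConditions.lowerSemicontinuous_lagrangian [IsMarkovKernel μ] (hL : LDPConditions μ)
    (hH : Continuous (fun q : Rd d × Rd d => (hamiltonian μ q.1 q.2).toReal)) :
    LowerSemicontinuous (fun q : Rd d × Rd d => lagrangian μ q.1 q.2) := by
  unfold lagrangian
  refine lowerSemicontinuous_iSup fun α => Continuous.lowerSemicontinuous ?_
  have : (fun q : Rd d × Rd d => ((inner ℝ α q.2 : ℝ) : EReal) - hamiltonian μ q.1 α) =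
      fun q => ((inner ℝ α q.2 - (hamiltonian μ q.1 α).toReal : ℝ) : EReal) := by
    funext q
    rw [EReal.coe_sub, hL.coe_hamiltonian]
  rw [this]
  refine continuous_coe_real_ereal.comp ?_
  have h2 : Continuous (fun q : Rd d × Rd d => (hamiltonian μ q.1 α).toReal) :=
    hH.comp (continuous_fst.prodMk continuous_const)
  fun_prop

/-- The running cost of a path of finite action is integrable. -/
lemma LDPConditions.integrableOn_lagrangian [IsMarkovKernel μ] (hL : LDPConditions μ)
    (hH : Continuous (fun q : Rd d × Rd d => (hamiltonian μ q.1 q.2).toReal))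
    {T : ℝ} (hT : 0 ≤ T) {φ : ℝ → Rd d} (hφ : action μ T φ < ∞) :
    IntegrableOn (fun t => (lagrangian μ (φ t) (deriv φ t)).toReal) (Icc 0 T) := by
  have hAC := absolutelyContinuous_of_action hφ
  have hφm : AEMeasurable φ (volume.restrict (Icc 0 T)) := by
    have := hAC.continuousOn
    rw [uIcc_of_le hT] at this
    exact this.aemeasurable measurableSet_Icc
  have hLm : Measurable (fun q : Rd d × Rd d => lagrangian μ q.1 q.2) :=
    (hL.lowerSemicontinuous_lagrangian hH).measurable
  have hφ'm : AEMeasurable (deriv φ) (volume.restrict (Icc 0 T)) :=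
    (measurable_deriv φ).aemeasurable
  have hpair : AEMeasurable (fun t => (φ t, deriv φ t)) (volume.restrict (Icc 0 T)) :=
    hφm.prodMk hφ'm
  have hm : AEMeasurable (fun t => lagrangian μ (φ t) (deriv φ t)) (volume.restrict (Icc 0 T)) :=
    hLm.comp_aemeasurable (f := fun t => (φ t, deriv φ t)) hpair
  rw [action_of_absolutelyContinuous hAC] at hφ
  have hm' : AEMeasurable (fun t => (lagrangian μ (φ t) (deriv φ t)).toReal)
      (volume.restrict (Icc 0 T)) := hm.ereal_toReal
  refine ⟨hm'.aestronglyMeasurable, ?_⟩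
  rw [hasFiniteIntegral_iff_ofReal
    (Filter.Eventually.of_forall fun t => lagrangian_toReal_nonneg _ _)]
  refine lt_of_le_of_lt (le_of_eq (lintegral_congr fun t => ?_)) hφ
  rw [EReal.toENNReal_of_ne_top (hL.lagrangian_lt_top _ _).ne]

/-- Along an optimal path the value function is the remaining running cost. -/
lemma IsNOP.valueFun_eq_integral [IsMarkovKernel μ] (hL : LDPConditions μ)
    (hH : Continuous (fun q : Rd d × Rd d => (hamiltonian μ q.1 q.2).toReal))
    {xT x₀ : Rd d} {T : ℝ} {φ : ℝ → Rd d} (hφ : IsNOP μ xT T x₀ φ) {t : ℝ}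
    (ht : t ∈ Icc 0 T) :
    valueFun μ xT T (φ t, t) =
      ∫ s in t..T, (lagrangian μ (φ s) (deriv φ s)).toReal := by
  have hT : 0 ≤ T := ht.1.trans ht.2
  have hAC := absolutelyContinuous_of_action hφ.finite
  have hACt : AbsolutelyContinuousOnInterval (fun u => φ (u + t)) 0 (T - t) :=
    absolutelyContinuousOnInterval_shift ht.1 (sub_nonneg.2 ht.2) (by simpa using hAC)
  have hint := hL.integrableOn_lagrangian hH hT hφ.finite
  unfold valueFun
  simp only
  rw [← hφ.action_shift ht.1 ht.2, action_of_absolutelyContinuous hACt,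
    intervalIntegral.integral_of_le ht.2, ← integral_Icc_eq_integral_Ioc,
    integral_eq_lintegral_of_nonneg_ae
      (Filter.Eventually.of_forall fun t => lagrangian_toReal_nonneg _ _)
      (hint.mono_set (Icc_subset_Icc_left ht.1)).aestronglyMeasurable]
  congr 1
  have h2 := (measurePreserving_add_right (volume : Measure ℝ) t).setLIntegral_comp_preimage_emb
    (measurableEmbedding_addRight t)
    (fun s => ENNReal.ofReal (lagrangian μ (φ s) (deriv φ s)).toReal) (Icc t T)
  rw [← h2]
  simp only [preimage_add_const_Icc, sub_self, deriv_comp_add_const]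
  refine lintegral_congr fun s => ?_
  rw [← hL.coe_lagrangian, EReal.toENNReal_of_ne_top (EReal.coe_ne_top _), EReal.toReal_coe]

lemma ae_differentiableAt_of_action {T : ℝ} (hT : 0 ≤ T) {φ : ℝ → Rd d}
    (hφ : action μ T φ < ∞) : ∀ᵐ t, t ∈ Icc 0 T → DifferentiableAt ℝ φ t := by
  have := (absolutelyContinuous_of_action hφ).boundedVariationOn.ae_differentiableAt_of_mem_uIcc
  rwa [uIcc_of_le hT] at this

/-- At almost every time the value function decreases along an optimal path exactly at the rate
of the running cost. -/
lemma IsNOP.ae_valueFun_deriv [IsMarkovKernel μ] (hL : LDPConditions μ)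
    (hH : Continuous (fun q : Rd d × Rd d => (hamiltonian μ q.1 q.2).toReal))
    {xT x₀ : Rd d} {T : ℝ} (hT : 0 ≤ T) {φ : ℝ → Rd d} (hφ : IsNOP μ xT T x₀ φ) :
    ∀ᵐ t, t ∈ Ioo 0 T → DifferentiableAt ℝ φ t ∧ ∀ V' : Rd d × ℝ →L[ℝ] ℝ,
      HasFDerivAt (valueFun μ xT T) V' (φ t, t) →
        V' (deriv φ t, 1) + (lagrangian μ (φ t) (deriv φ t)).toReal = 0 := by
  have hint : IntervalIntegrable (fun t => (lagrangian μ (φ t) (deriv φ t)).toReal) volume 0 T :=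
    (intervalIntegrable_iff_integrableOn_Icc_of_le hT).2
      (hL.integrableOn_lagrangian hH hT hφ.finite)
  filter_upwards [ae_differentiableAt_of_action hT hφ.finite, hint.ae_hasDerivAt_integral]
    with t h1 h2 ht
  have hd := h1 (Ioo_subset_Icc_self ht)
  refine ⟨hd, fun V' hV => ?_⟩
  have h3 := h2 (by rw [uIcc_of_le hT]; exact Ioo_subset_Icc_self ht) T right_mem_uIcc
  have h4 : HasDerivAt (fun s => valueFun μ xT T (φ s, s)) (V' (deriv φ t, 1)) t :=
    HasFDerivAt.comp_hasDerivAt (f := fun s => (φ s, s)) t hV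
      (hd.hasDerivAt.prodMk (hasDerivAt_id t))
  have h5 : (fun s => valueFun μ xT T (φ s, s)) =ᶠ[𝓝 t]
      fun s => -∫ u in T..s, (lagrangian μ (φ u) (deriv φ u)).toReal := by
    filter_upwards [Ioo_mem_nhds ht.1 ht.2] with s hs
    rw [hφ.valueFun_eq_integral hL hH (Ioo_subset_Icc_self hs), ← intervalIntegral.integral_symm]
  have := h4.unique (h3.neg.congr_of_eventuallyEq h5)
  linarith

/-- Where the value function is differentiable, the velocity of an optimal path is almost
everywhere the limiting drift. -/
lemma IsNOP.ae_deriv_eq_limitDrift [IsMarkovKernel μ] (hL : LDPConditions μ)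
    (hH : Differentiable ℝ (fun q : Rd d × Rd d => (hamiltonian μ q.1 q.2).toReal))
    {xT x₀ : Rd d} {T : ℝ} (hT : 0 ≤ T) {φ : ℝ → Rd d} (hφ : IsNOP μ xT T x₀ φ) :
    ∀ᵐ t, t ∈ Ioo 0 T → DifferentiableAt ℝ (valueFun μ xT T) (φ t, t) →
      HasDerivAt φ (limitDrift μ xT T (φ t) t) t := by
  filter_upwards [hφ.ae_valueFun_deriv hL hH.continuous hT] with t h ht hV
  obtain ⟨hd, h⟩ := h ht
  have h0 := h _ hV.hasFDerivAt
  set V' := fderiv ℝ (valueFun μ xT T) (φ t, t)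
  suffices deriv φ t = limitDrift μ xT T (φ t) t from this ▸ hd.hasDerivAt
  unfold limitDrift
  set p := gradient (fun y => (quasiPotential μ xT (T - t) y).toReal) (φ t) with hp
  have hgrad : ∀ v : Rd d, inner ℝ p v = V' (v, 0) := by
    intro v
    have h1 : HasFDerivAt (fun y => valueFun μ xT T (y, t))
        (V'.comp (ContinuousLinearMap.inl ℝ (Rd d) ℝ)) (φ t) :=
      HasFDerivAt.comp (g := valueFun μ xT T) (f := fun y => (y, t)) (φ t) hV.hasFDerivAt
        (hasFDerivAt_prodMk_left (φ t) t)
    have h2 : fderiv ℝ (fun y => (quasiPotential μ xT (T - t) y).toReal) (φ t) =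
        V'.comp (ContinuousLinearMap.inl ℝ (Rd d) ℝ) := h1.fderiv
    rw [hp, gradient, h2, InnerProductSpace.toDual_symm_apply]
    simp
  have hdH : Differentiable ℝ (fun α => (hamiltonian μ (φ t) α).toReal) :=
    hH.comp ((differentiable_const _).prodMk differentiable_id)
  refine hL.eq_gradient_hamiltonian (φ t) (-p) _ (hdH _) ?_
  have h1 := hL.valueFun_deriv_ge ht.2 hV.hasFDerivAt
    (gradient (fun α => (hamiltonian μ (φ t) α).toReal) (-p))
  have hsplit : ∀ v : Rd d, V' (v, 1) = inner ℝ p v + V' (0, 1) := by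
    intro v
    rw [hgrad, ← map_add]
    simp
  rw [hsplit] at h0
  erw [hsplit] at h1
  simp only [inner_neg_left]
  linarith

end HamiltonJacobi

/-! ### Regularity of the limiting drift near the optimal path -/

section Drift

variable {d : ℕ} {μ : Kernel (Rd d) (Rd d)}

lemma isOpen_tube (φ : ℝ → Rd d) (δ₀ Ts : ℝ) : IsOpen (tube φ δ₀ Ts) :=
  isOpen_biUnion fun _ _ => Metric.isOpen_ball

lemma mem_tube {φ : ℝ → Rd d} {δ₀ Ts t : ℝ} (ht : t ∈ Icc 0 Ts) {x : Rd d}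
    (hx : ‖x - φ t‖ < δ₀) : x ∈ tube φ δ₀ Ts :=
  mem_biUnion ht (by rwa [Metric.mem_ball, dist_eq_norm])

/-- The limiting drift is `C¹` where the value function is `C²`. -/
lemma contDiffOn_limitDrift
    (hH : ContDiff ℝ 2 (fun q : Rd d × Rd d => (hamiltonian μ q.1 q.2).toReal))
    {xT : Rd d} {T : ℝ} {U : Set (Rd d)} (hU : IsOpen U) {Ts : ℝ} (hTs : 0 < Ts)
    (hV : ContDiffOn ℝ 2 (valueFun μ xT T) (U ×ˢ Icc 0 Ts)) :
    ContDiffOn ℝ 1 (fun q : Rd d × ℝ => limitDrift μ xT T q.1 q.2) (U ×ˢ Icc 0 Ts) := by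
  have huniq : UniqueDiffOn ℝ (U ×ˢ Icc 0 Ts) := hU.uniqueDiffOn.prod (uniqueDiffOn_Icc hTs)
  have hgrad : ContDiffOn ℝ 1 (fun q : Rd d × ℝ =>
      gradient (fun y => (quasiPotential μ xT (T - q.2) y).toReal) q.1) (U ×ˢ Icc 0 Ts) := by
    have h1 : ContDiffOn ℝ 1 (fun q => (InnerProductSpace.toDual ℝ (Rd d)).symm
        ((fderivWithin ℝ (valueFun μ xT T) (U ×ˢ Icc 0 Ts) q).comp
          (ContinuousLinearMap.inl ℝ (Rd d) ℝ))) (U ×ˢ Icc 0 Ts) := by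
      have h2 := hV.fderivWithin huniq (m := 1) (by norm_num)
      have h3 := h2.clm_comp (contDiffOn_const (c := ContinuousLinearMap.inl ℝ (Rd d) ℝ))
      exact (InnerProductSpace.toDual ℝ (Rd d)).symm.contDiff.comp_contDiffOn h3
    refine h1.congr fun q hq => ?_
    have h2 := (hV.differentiableOn (by norm_num) q hq).hasFDerivWithinAt
    have h3 := HasFDerivWithinAt.comp (g := valueFun μ xT T) (f := fun y => (y, q.2)) q.1 h2
      (hasFDerivAt_prodMk_left q.1 q.2).hasFDerivWithinAt (s := U) (fun y hy => ⟨hy, hq.2⟩)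
    have h4 := (h3.hasFDerivAt (hU.mem_nhds hq.1)).fderiv
    rw [gradient, ← h4]
    rfl
  have hgradH : ContDiff ℝ 1 (fun q : Rd d × Rd d =>
      gradient (fun α => (hamiltonian μ q.1 α).toReal) q.2) := by
    have h1 : ContDiff ℝ 1 (fun q => (InnerProductSpace.toDual ℝ (Rd d)).symm
        ((fderiv ℝ (fun q : Rd d × Rd d => (hamiltonian μ q.1 q.2).toReal) q).comp
          (ContinuousLinearMap.inr ℝ (Rd d) (Rd d)))) := by
      have h2 := hH.fderiv_right (m := 1) (by norm_num)
      have h3 := h2.clm_comp (contDiff_const (c := ContinuousLinearMap.inr ℝ (Rd d) (Rd d)))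
      exact (InnerProductSpace.toDual ℝ (Rd d)).symm.contDiff.comp h3
    convert h1 using 2 with q
    have h2 := (hH.differentiable (by norm_num) q).hasFDerivAt
    have h3 := HasFDerivAt.comp (g := fun q : Rd d × Rd d => (hamiltonian μ q.1 q.2).toReal)
      (f := fun α => (q.1, α)) q.2 h2 (hasFDerivAt_prodMk_right q.1 q.2)
    rw [gradient, ← h3.fderiv]
    rfl
  exact hgradH.comp_contDiffOn (contDiffOn_fst.prodMk hgrad.neg)

/-- A drift that is `C¹` near the graph of a continuous path is Lipschitz in space near the path,
uniformly in time. -/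
lemma exists_lipschitz_near_path {b : Rd d × ℝ → Rd d} {φ : ℝ → Rd d} {δ₁ Ts : ℝ} (hδ₁ : 0 < δ₁)
    (hφ : ContinuousOn φ (Icc 0 Ts)) (hb : ContDiffOn ℝ 1 b (tube φ δ₁ Ts ×ˢ Icc 0 Ts)) :
    ∃ K : ℝ≥0, ∃ r > 0, ∀ t ∈ Icc 0 Ts, ∀ x, ‖x - φ t‖ < r →
      ‖b (x, t) - b (φ t, t)‖ ≤ K * ‖x - φ t‖ := by
  refine isCompact_Icc.induction_on (p := fun A => ∃ K : ℝ≥0, ∃ r > 0, ∀ t ∈ A, ∀ x,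
    ‖x - φ t‖ < r → ‖b (x, t) - b (φ t, t)‖ ≤ K * ‖x - φ t‖) ?_ ?_ ?_ ?_
  · exact ⟨0, 1, one_pos, by simp⟩
  · rintro A B hAB ⟨K, r, hr, h⟩
    exact ⟨K, r, hr, fun t ht => h t (hAB ht)⟩
  · rintro A B ⟨K, r, hr, h⟩ ⟨K', r', hr', h'⟩
    refine ⟨max K K', min r r', lt_min hr hr', fun t ht x hx => ?_⟩
    rw [lt_min_iff] at hx
    rcases ht with ht | ht
    · exact (h t ht x hx.1).trans (by gcongr; exact le_max_left _ _)
    · exact (h' t ht x hx.2).trans (by gcongr; exact le_max_right _ _)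
  · intro t ht
    have hmem : (φ t, t) ∈ tube φ δ₁ Ts ×ˢ Icc 0 Ts := ⟨mem_tube ht (by simpa), ht⟩
    have hnh : tube φ δ₁ Ts ×ˢ Icc 0 Ts ∈ 𝓝[univ ×ˢ Icc 0 Ts] (φ t, t) := by
      have : tube φ δ₁ Ts ×ˢ (univ : Set ℝ) ∈ 𝓝 (φ t, t) :=
        ((isOpen_tube φ δ₁ Ts).prod isOpen_univ).mem_nhds ⟨hmem.1, mem_univ _⟩
      filter_upwards [mem_nhdsWithin_of_mem_nhds this, self_mem_nhdsWithin] with q h1 h2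
        using ⟨h1.1, h2.2⟩
    have hc := (hb _ hmem).mono_of_mem_nhdsWithin hnh
    obtain ⟨K, u, hu, hK⟩ := hc.exists_lipschitzOnWith (convex_univ.prod (convex_Icc 0 Ts))
    obtain ⟨r, hr, hru⟩ := Metric.mem_nhdsWithin_iff.1 hu
    refine ⟨{s | s ∈ Icc 0 Ts ∧ dist s t < r ∧ dist (φ s) (φ t) < r / 2}, ?_, K, r / 2, by
      positivity, ?_⟩
    · filter_upwards [self_mem_nhdsWithin,
        mem_nhdsWithin_of_mem_nhds (Metric.ball_mem_nhds t hr),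
        (hφ t ht).eventually (Metric.ball_mem_nhds (φ t) (half_pos hr))] with s h1 h2 h3
        using ⟨h1, h2, h3⟩
    · rintro s ⟨hs, hst, hφs⟩ x hx
      have h1 : (φ s, s) ∈ u := hru ⟨by
        rw [Metric.mem_ball, Prod.dist_eq, max_lt_iff]
        exact ⟨by dsimp only; linarith, hst⟩, mem_univ _, hs⟩
      have h2 : (x, s) ∈ u := hru ⟨by
        rw [Metric.mem_ball, Prod.dist_eq, max_lt_iff]
        refine ⟨?_, hst⟩
        have := dist_triangle x (φ s) (φ t)
        rw [← dist_eq_norm] at hx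
        dsimp only
        linarith, mem_univ _, hs⟩
      have h3 := hK.dist_le_mul _ h2 _ h1
      rw [dist_eq_norm, Prod.dist_eq, dist_self, max_eq_left dist_nonneg, dist_eq_norm] at h3
      exact h3

/-- An absolutely continuous path whose velocity is almost everywhere equal to a continuous
function `g` has, uniformly, the first order expansion with slope `g`. -/
lemma exists_norm_sub_le_of_ae_hasDerivAt {φ g : ℝ → Rd d} {Ts : ℝ} (hTs : 0 ≤ Ts)
    (hφ : AbsolutelyContinuousOnInterval φ 0 Ts) (hg : ContinuousOn g (Icc 0 Ts))
    (hd : ∀ᵐ t, t ∈ Ioo 0 Ts → HasDerivAt φ (g t) t) {η : ℝ} (hη : 0 < η) :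
    ∃ h₀ > 0, ∀ s ∈ Icc 0 Ts, ∀ t ∈ Icc 0 Ts, s ≤ t → t - s < h₀ →
      ‖φ t - φ s - (t - s) • g s‖ ≤ η * (t - s) := by
  have hint : IntervalIntegrable g volume 0 Ts := hg.intervalIntegrable_of_Icc hTs
  have hsub : ∀ s ∈ Icc 0 Ts, ∀ t ∈ Icc 0 Ts, IntervalIntegrable g volume s t :=
    fun s hs t ht => hint.mono_set (by
      rw [uIcc_of_le hTs]
      exact uIcc_subset_Icc hs ht)
  obtain ⟨C, hC⟩ := isCompact_Icc.exists_bound_of_continuousOn hg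
  have hAC : AbsolutelyContinuousOnInterval (fun t => ∫ u in 0..t, g u) 0 Ts := by
    refine LipschitzOnWith.absolutelyContinuousOnInterval (K := C.toNNReal) ?_
    rw [uIcc_of_le hTs]
    refine LipschitzOnWith.of_dist_le_mul fun t ht s hs => ?_
    have h0 : (0 : ℝ) ∈ Icc 0 Ts := ⟨le_rfl, hTs⟩
    rw [dist_eq_norm, intervalIntegral.integral_interval_sub_left (hsub 0 h0 t ht)
      (hsub 0 h0 s hs), Real.dist_eq]
    refine intervalIntegral.norm_integral_le_of_norm_le_const fun u hu => ?_
    refine (hC u ?_).trans (Real.le_coe_toNNReal C)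
    exact uIcc_subset_Icc hs ht (uIoc_subset_uIcc hu)
  have hconst : ∀ᵐ t, t ∈ uIcc 0 Ts →
      HasDerivAt (φ - fun t => ∫ u in 0..t, g u) 0 t := by
    filter_upwards [hd, hint.ae_hasDerivAt_integral, Measure.ae_ne volume (0 : ℝ),
      Measure.ae_ne volume Ts] with t h1 h2 h3 h3' ht
    have ht' : t ∈ Icc 0 Ts := by rwa [uIcc_of_le hTs] at ht
    have h4 : t ∈ Ioo 0 Ts := ⟨lt_of_le_of_ne ht'.1 (Ne.symm h3), lt_of_le_of_ne ht'.2 h3'⟩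
    simpa using (h1 h4).sub (h2 ht 0 left_mem_uIcc)
  obtain ⟨c, hc⟩ := (hφ.sub hAC).const_of_ae_hasDerivAt_zero hconst
  rw [uIcc_of_le hTs] at hc
  obtain ⟨h₀, hh₀, hu⟩ := Metric.uniformContinuousOn_iff.1
    (isCompact_Icc.uniformContinuousOn_of_continuous hg) η hη
  refine ⟨h₀, hh₀, fun s hs t ht hst hlt => ?_⟩
  have h0 : (0 : ℝ) ∈ Icc 0 Ts := ⟨le_rfl, hTs⟩
  have h1 : φ t - φ s = ∫ u in s..t, g u := by
    rw [← intervalIntegral.integral_interval_sub_left (hsub 0 h0 t ht) (hsub 0 h0 s hs)]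
    have e := (hc t ht).trans (hc s hs).symm
    simp only [Pi.sub_apply] at e
    rw [sub_eq_sub_iff_add_eq_add] at e ⊢
    rw [add_comm _ (φ s), ← e]
  rw [h1, ← intervalIntegral.integral_const, ← intervalIntegral.integral_sub (hsub s hs t ht)
    intervalIntegrable_const]
  refine (intervalIntegral.norm_integral_le_of_norm_le_const (C := η) fun u hu' => ?_).trans
    (by rw [abs_of_nonneg (sub_nonneg.2 hst)])
  rw [uIoc_of_le hst] at hu'
  have := hu u ⟨hs.1.trans hu'.1.le, hu'.2.trans ht.2⟩ s hs (by
    rw [Real.dist_eq, abs_of_pos (sub_pos.2 hu'.1)]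
    linarith [hu'.2])
  rw [dist_eq_norm] at this
  exact this.le

/-- The optimal path solves the differential equation of the limiting drift. -/
lemma IsNOP.exists_norm_sub_limitDrift_le [IsMarkovKernel μ] (hL : LDPConditions μ)
    (hH : ContDiff ℝ 2 (fun q : Rd d × Rd d => (hamiltonian μ q.1 q.2).toReal))
    {xT x₀ : Rd d} {T : ℝ} {φ : ℝ → Rd d} (hφ : IsNOP μ xT T x₀ φ) {Ts : ℝ} (hTs : Ts ∈ Ioo 0 T)
    {δ₁ : ℝ} (hδ₁ : 0 < δ₁)
    (hV : ContDiffOn ℝ 2 (valueFun μ xT T) (tube φ δ₁ Ts ×ˢ Icc 0 Ts)) {η : ℝ} (hη : 0 < η) :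
    ∃ h₀ > 0, ∀ s ∈ Icc 0 Ts, ∀ t ∈ Icc 0 Ts, s ≤ t → t - s < h₀ →
      ‖φ t - φ s - (t - s) • limitDrift μ xT T (φ s) s‖ ≤ η * (t - s) := by
  have hT : 0 ≤ T := (hTs.1.trans hTs.2).le
  have hAC : AbsolutelyContinuousOnInterval φ 0 Ts :=
    (absolutelyContinuous_of_action hφ.finite).mono (by
      rw [uIcc_of_le hTs.1.le, uIcc_of_le hT]
      exact Icc_subset_Icc_right hTs.2.le)
  have hφc : ContinuousOn φ (Icc 0 Ts) := by
    have := hAC.continuousOn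
    rwa [uIcc_of_le hTs.1.le] at this
  have hmaps : MapsTo (fun t => (φ t, t)) (Icc 0 Ts) (tube φ δ₁ Ts ×ˢ Icc 0 Ts) :=
    fun t ht => ⟨mem_tube ht (by simpa), ht⟩
  refine exists_norm_sub_le_of_ae_hasDerivAt hTs.1.le hAC ?_ ?_ hη
  · have hb := (contDiffOn_limitDrift hH (isOpen_tube φ δ₁ Ts) hTs.1 hV).continuousOn
    exact ContinuousOn.comp (g := fun q : Rd d × ℝ => limitDrift μ xT T q.1 q.2)
      (f := fun t => (φ t, t)) hb (hφc.prodMk continuousOn_id) hmaps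
  · filter_upwards [hφ.ae_deriv_eq_limitDrift hL (hH.differentiable (by norm_num)) hT]
      with t h ht
    refine h ⟨ht.1, ht.2.trans hTs.2⟩ ?_
    refine (hV.differentiableOn (by norm_num)).differentiableAt (prod_mem_nhds ?_ ?_)
    · exact (isOpen_tube φ δ₁ Ts).mem_nhds (hmaps (Ioo_subset_Icc_self ht)).1
    · exact Icc_mem_nhds ht.1 ht.2

end Drift

/-! ### A Lyapunov function of linear growth -/

section Lyapunov

variable {E : Type*} [NormedAddCommGroup E]

/-- The function `√(1 + ‖a‖²) - 1`: quadratic near the origin and of linear growth, so that a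
moment of order `1 + κ` of the noise controls its second order remainder. -/
noncomputable def softNorm (a : E) : ℝ := √(1 + ‖a‖ ^ 2) - 1

lemma softNorm_nonneg (a : E) : 0 ≤ softNorm a := by
  have : (1 : ℝ) ≤ √(1 + ‖a‖ ^ 2) := Real.one_le_sqrt.2 (by nlinarith [sq_nonneg ‖a‖])
  unfold softNorm
  linarith

@[simp]
lemma softNorm_zero : softNorm (0 : E) = 0 := by simp [softNorm]

lemma softNorm_pos {a : E} (ha : a ≠ 0) : 0 < softNorm a := by
  have h : 0 < ‖a‖ ^ 2 := by positivity
  have : (1 : ℝ) < √(1 + ‖a‖ ^ 2) := by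
    rw [Real.lt_sqrt (by norm_num)]
    linarith
  unfold softNorm
  linarith

lemma continuous_softNorm : Continuous (softNorm : E → ℝ) := by
  unfold softNorm
  fun_prop

lemma softNorm_le_of_norm_le {F : Type*} [NormedAddCommGroup F] {a : E}
    {b : F} (h : ‖a‖ ≤ ‖b‖) : softNorm a ≤ softNorm b := by
  unfold softNorm
  gcongr

/-- `softNorm` of `(1 + c) ‖a‖ + e` is at most `(1 + c)² softNorm a + e`, by concavity of the
square root. -/
lemma softNorm_le_of_norm_le_add {a b : E} {c e : ℝ} (hc : 0 ≤ c) (he : 0 ≤ e)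
    (h : ‖b‖ ≤ (1 + c) * ‖a‖ + e) : softNorm b ≤ (1 + c) ^ 2 * softNorm a + e := by
  unfold softNorm
  set s := √(1 + ‖a‖ ^ 2) with hs
  have hs2 : s ^ 2 = 1 + ‖a‖ ^ 2 := Real.sq_sqrt (by positivity)
  have hs1 : 1 ≤ s := Real.one_le_sqrt.2 (by nlinarith [sq_nonneg ‖a‖])
  have has : ‖a‖ ≤ s := by
    rw [hs]
    exact Real.le_sqrt_of_sq_le (by linarith)
  set k := (1 + c) ^ 2 with hk
  have hk1 : 1 ≤ k := by nlinarith
  have hn := norm_nonneg a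
  -- `√(1 + k ‖a‖²) ≤ 1 + k (s - 1)` is the concavity of `√(1 + ·) - 1` with `k ≥ 1`; adding `e` to
  -- the norm adds at most `e` to the root
  have hm : (1 + c) * ‖a‖ ≤ k * (s - 1) + 1 := by
    have : ((1 + c) * ‖a‖) ^ 2 ≤ (k * (s - 1) + 1) ^ 2 := by
      have e1 : ((1 + c) * ‖a‖) ^ 2 = k * (s ^ 2 - 1) := by rw [hs2, hk]; ring
      rw [e1]
      nlinarith [mul_nonneg (sub_nonneg.2 hk1) (sq_nonneg (s - 1)),
        mul_nonneg (by linarith : (0:ℝ) ≤ k) (sub_nonneg.2 hs1)]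
    exact le_of_sq_le_sq this (by nlinarith)
  have hle : √(1 + ‖b‖ ^ 2) ≤ k * (s - 1) + 1 + e := by
    refine Real.sqrt_le_iff.2 ⟨by nlinarith, ?_⟩
    have hb : ‖b‖ ^ 2 ≤ ((1 + c) * ‖a‖ + e) ^ 2 :=
      pow_le_pow_left₀ (norm_nonneg b) h 2
    have e1 : ((1 + c) * ‖a‖) ^ 2 = k * (s ^ 2 - 1) := by rw [hs2, hk]; ring
    have e2 : k * (s ^ 2 - 1) + 1 ≤ (k * (s - 1) + 1) ^ 2 := by
      nlinarith [mul_nonneg (mul_nonneg (by linarith : (0:ℝ) ≤ k) (sub_nonneg.2 hk1))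
        (sq_nonneg (s - 1))]
    nlinarith [mul_le_mul_of_nonneg_right hm he]
  linarith

/-- First order expansion of `softNorm` with a remainder of order `1 + κ`. -/
lemma softNorm_add_le [InnerProductSpace ℝ E] {κ : ℝ} (hκ : κ ∈ Ioc (0 : ℝ) 1) (a h : E) :
    softNorm (a + h) ≤ softNorm a + inner ℝ ((√(1 + ‖a‖ ^ 2))⁻¹ • a) h + 2 * ‖h‖ ^ (1 + κ) := by
  unfold softNorm
  set s := √(1 + ‖a‖ ^ 2) with hs
  have hs2 : s ^ 2 = 1 + ‖a‖ ^ 2 := Real.sq_sqrt (by positivity)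
  have hs1 : 1 ≤ s := Real.one_le_sqrt.2 (by nlinarith [sq_nonneg ‖a‖])
  have hs0 : 0 < s := by linarith
  have has : ‖a‖ ≤ s := by
    rw [hs]
    exact Real.le_sqrt_of_sq_le (by linarith)
  have hexp : ‖a + h‖ ^ 2 = ‖a‖ ^ 2 + 2 * inner ℝ a h + ‖h‖ ^ 2 := norm_add_sq_real a h
  rw [inner_smul_left]
  simp only [conj_trivial]
  set i := inner ℝ a h with hi
  have hi' : |i| ≤ ‖a‖ * ‖h‖ := abs_real_inner_le_norm a h
  have hsi : |s⁻¹ * i| ≤ ‖h‖ := by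
    rw [abs_mul, abs_of_pos (inv_pos.2 hs0), inv_mul_le_iff₀ hs0]
    exact hi'.trans (mul_le_mul_of_nonneg_right has (norm_nonneg h))
  have hn := norm_nonneg h
  rcases le_total ‖h‖ 1 with hh | hh
  · have h1 : ‖h‖ ^ 2 ≤ ‖h‖ ^ (1 + κ) := by
      rcases hn.eq_or_lt with h0 | h0
      · rw [← h0, Real.zero_rpow (by linarith [hκ.1])]
        norm_num
      · rw [← Real.rpow_natCast]
        exact Real.rpow_le_rpow_of_exponent_ge h0 hh (by push_cast; linarith [hκ.2])
    have h2 : √(1 + ‖a + h‖ ^ 2) ≤ s + s⁻¹ * i + ‖h‖ ^ 2 := by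
      -- concavity of the square root: `√v ≤ (v + s²) / (2 s)`
      have hii : s * (s⁻¹ * i) = i := by field_simp
      have hv : √(1 + ‖a + h‖ ^ 2) ^ 2 = 1 + ‖a + h‖ ^ 2 := Real.sq_sqrt (by positivity)
      refine le_of_mul_le_mul_left ?_ hs0
      nlinarith [sq_nonneg (√(1 + ‖a + h‖ ^ 2) - s),
        mul_nonneg (sub_nonneg.2 hs1) (sq_nonneg ‖h‖), sq_nonneg ‖h‖]
    linarith [sq_nonneg ‖h‖]
  · have h1 : ‖h‖ ≤ ‖h‖ ^ (1 + κ) := by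
      conv_lhs => rw [← Real.rpow_one ‖h‖]
      exact Real.rpow_le_rpow_of_exponent_le hh (by linarith [hκ.1])
    have h2 : √(1 + ‖a + h‖ ^ 2) ≤ s + ‖h‖ := by
      refine Real.sqrt_le_iff.2 ⟨by positivity, ?_⟩
      rw [hexp]
      nlinarith [le_of_abs_le hi', mul_le_mul_of_nonneg_right has hn]
    have := neg_le_of_abs_le hsi
    linarith

end Lyapunov

section OneStep

variable {E : Type*} [NormedAddCommGroup E] [InnerProductSpace ℝ E] [CompleteSpace E]
  [MeasurableSpace E] [BorelSpace E] [SecondCountableTopology E]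

/-- A jump `ε z` whose law has a bounded centred moment of order `1 + κ` increases `softNorm`
on average by no more than its mean does, up to `O(ε^(1+κ))`. -/
lemma lintegral_softNorm_add_smul_le {κ : ℝ} (hκ : κ ∈ Ioc (0 : ℝ) 1) (ν : Measure E)
    [IsProbabilityMeasure ν] (hint : ∫⁻ z, ‖z‖ₑ ∂ν ≠ ∞) {G : ℝ≥0}
    (hG : ∫⁻ z, ‖z - ∫ w, w ∂ν‖ₑ ^ (1 + κ) ∂ν ≤ G) (a : E) {ε : ℝ} (hε : 0 ≤ ε) :
    ∫⁻ z, ENNReal.ofReal (softNorm (a + ε • z)) ∂ν ≤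
      ENNReal.ofReal (softNorm (a + ε • ∫ w, w ∂ν) + 2 * ε ^ (1 + κ) * G) := by
  set b := ∫ w, w ∂ν with hb
  set a' := a + ε • b with ha'
  set w := (√(1 + ‖a'‖ ^ 2))⁻¹ • a' with hw
  have hκ0 : 0 ≤ 1 + κ := by linarith [hκ.1]
  have hid : Integrable (fun z : E => z) ν :=
    ⟨aestronglyMeasurable_id, lt_top_iff_ne_top.2 hint⟩
  have hzb : Integrable (fun z => z - b) ν := hid.sub (integrable_const b)
  have hcentre : ∫ z, inner ℝ w (z - b) ∂ν = 0 := by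
    rw [integral_inner hzb w, integral_sub hid (integrable_const b)]
    simp [hb]
  have hpow : ∀ z, ENNReal.ofReal (‖z - b‖ ^ (1 + κ)) = ‖z - b‖ₑ ^ (1 + κ) := fun z => by
    rw [← ENNReal.ofReal_rpow_of_nonneg (norm_nonneg _) hκ0, ofReal_norm]
  have hmom : Integrable (fun z => ‖z - b‖ ^ (1 + κ)) ν := by
    refine ⟨(by fun_prop : Measurable fun z => ‖z - b‖ ^ (1 + κ)).aestronglyMeasurable, ?_⟩
    rw [hasFiniteIntegral_iff_ofReal (Filter.Eventually.of_forall fun z => by positivity)]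
    simp only [hpow]
    exact lt_of_le_of_lt hG ENNReal.coe_lt_top
  have hmomG : ∫ z, ‖z - b‖ ^ (1 + κ) ∂ν ≤ G := by
    rw [integral_eq_lintegral_of_nonneg_ae (Filter.Eventually.of_forall fun z => by positivity)
      hmom.aestronglyMeasurable]
    simp only [hpow]
    exact ENNReal.toReal_le_coe_of_le_coe hG
  set F : E → ℝ := fun z =>
    (softNorm a' + ε * inner ℝ w (z - b)) + (2 * ε ^ (1 + κ)) * ‖z - b‖ ^ (1 + κ) with hF
  have hI1 : Integrable (fun z => inner ℝ w (z - b)) ν := hzb.const_inner w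
  have hI2 : Integrable (fun z => softNorm a' + ε * inner ℝ w (z - b)) ν :=
    (integrable_const _).add (hI1.const_mul ε)
  have hI3 : Integrable (fun z => (2 * ε ^ (1 + κ)) * ‖z - b‖ ^ (1 + κ)) ν := hmom.const_mul _
  have hle : ∀ z, softNorm (a + ε • z) ≤ F z := by
    intro z
    have h1 : a + ε • z = a' + ε • (z - b) := by
      rw [ha', smul_sub]
      abel
    rw [h1]
    refine (softNorm_add_le hκ a' (ε • (z - b))).trans (le_of_eq ?_)
    rw [norm_smul, Real.norm_of_nonneg hε, Real.mul_rpow hε (norm_nonneg _), inner_smul_right]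
    simp only [hF, hw]
    ring
  calc ∫⁻ z, ENNReal.ofReal (softNorm (a + ε • z)) ∂ν
      ≤ ∫⁻ z, ENNReal.ofReal (F z) ∂ν :=
        lintegral_mono fun z => ENNReal.ofReal_le_ofReal (hle z)
    _ = ENNReal.ofReal (∫ z, F z ∂ν) :=
        (ofReal_integral_eq_lintegral_ofReal (hI2.add hI3)
          (Filter.Eventually.of_forall fun z => (softNorm_nonneg _).trans (hle z))).symm
    _ ≤ _ := by
        refine ENNReal.ofReal_le_ofReal ?_
        simp only [hF]
        rw [integral_add hI2 hI3, integral_add (integrable_const _) (hI1.const_mul ε),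
          integral_const_mul, integral_const_mul, hcentre]
        simp only [integral_const, probReal_univ, one_smul, mul_zero, add_zero]
        gcongr

end OneStep

/-! ### Integration against conditional laws -/

section ConditionalLaw

variable {Ω E F : Type*} {m mΩ : MeasurableSpace Ω} [MeasurableSpace E] [MeasurableSpace F]
  {P : Measure Ω} [IsProbabilityMeasure P] {Y : Ω → E} {Z : Ω → F}
  {κ : Kernel E F}

lemma ae_isProbabilityMeasure_of_condExp (hm : m ≤ mΩ)
    (hlaw : ∀ D, MeasurableSet D → P[(Z ⁻¹' D).indicator (fun _ => (1 : ℝ)) | m]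
      =ᵐ[P] fun ω => (κ (Y ω)).real D) :
    ∀ᵐ ω ∂P, IsProbabilityMeasure (κ (Y ω)) := by
  have h := hlaw univ MeasurableSet.univ
  simp only [preimage_univ, indicator_univ] at h
  rw [condExp_const hm] at h
  filter_upwards [h] with ω hω
  refine ⟨?_⟩
  rw [← ENNReal.toReal_eq_one_iff]
  exact hω.symm

/-- If `κ (Y)` is the conditional law of `Z` given a σ-algebra `m` with respect to which `Y` is
measurable, then functions of `(Y, Z)` are integrated over events of `m` by first integrating
against `κ (Y)`. -/
lemma setLIntegral_eq_of_condExp [IsSFiniteKernel κ] (hm : m ≤ mΩ) (hY : Measurable[m] Y)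
    (hZ : Measurable Z)
    (hlaw : ∀ D, MeasurableSet D → P[(Z ⁻¹' D).indicator (fun _ => (1 : ℝ)) | m]
      =ᵐ[P] fun ω => (κ (Y ω)).real D)
    {A : Set Ω} (hA : MeasurableSet[m] A) {h : E × F → ℝ≥0∞} (hh : Measurable h) :
    ∫⁻ ω in A, h (Y ω, Z ω) ∂P = ∫⁻ ω in A, ∫⁻ z, h (Y ω, z) ∂(κ (Y ω)) ∂P := by
  have hY' : Measurable Y := hY.mono hm le_rfl
  have hprob := ae_isProbabilityMeasure_of_condExp hm hlaw
  have hmeas : (P.restrict A).map (fun ω => (Y ω, Z ω)) = ((P.restrict A).map Y) ⊗ₘ κ := by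
    refine Measure.ext_prod fun {B D} hB hD => ?_
    have hAB : MeasurableSet[m] (A ∩ Y ⁻¹' B) := hA.inter (hY hB)
    rw [Measure.compProd_apply_prod hB hD, setLIntegral_map hB (κ.measurable_coe hD) hY',
      Measure.restrict_restrict (hY' hB), Measure.map_apply (hY'.prodMk hZ) (hB.prod hD),
      Measure.restrict_apply ((hY'.prodMk hZ) (hB.prod hD)), inter_comm (Y ⁻¹' B) A]
    have hint : Integrable ((Z ⁻¹' D).indicator (fun _ => (1 : ℝ))) P :=
      (integrable_const 1).indicator (hZ hD)
    have h1 := setIntegral_condExp hm hint hAB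
    rw [integral_indicator_const (1 : ℝ) (hZ hD), smul_eq_mul, mul_one,
      setIntegral_congr_ae (hm _ hAB) ((hlaw D hD).mono fun ω hω _ => hω),
      integral_eq_lintegral_of_nonneg_ae
        (Filter.Eventually.of_forall fun ω => measureReal_nonneg)
        ((integrable_condExp.congr (hlaw D hD)).aestronglyMeasurable.restrict)] at h1
    have h2 : ∫⁻ ω in A ∩ Y ⁻¹' B, ENNReal.ofReal ((κ (Y ω)).real D) ∂P =
        ∫⁻ ω in A ∩ Y ⁻¹' B, κ (Y ω) D ∂P := by
      refine lintegral_congr_ae (ae_restrict_of_ae ?_)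
      filter_upwards [hprob] with ω hω
      exact ENNReal.ofReal_toReal (measure_ne_top _ _)
    have h3 : ∫⁻ ω in A ∩ Y ⁻¹' B, κ (Y ω) D ∂P ≠ ∞ := by
      refine ne_top_of_le_ne_top (ENNReal.one_ne_top) ?_
      calc ∫⁻ ω in A ∩ Y ⁻¹' B, κ (Y ω) D ∂P ≤ ∫⁻ ω, κ (Y ω) D ∂P := setLIntegral_le_lintegral _ _
        _ ≤ ∫⁻ _, 1 ∂P := lintegral_mono_ae (hprob.mono fun ω hω => prob_le_one)
        _ = 1 := by simp
    rw [h2, measureReal_def, ENNReal.toReal_eq_toReal_iff' h3 (measure_ne_top _ _),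
      Measure.restrict_apply (hZ hD)] at h1
    rw [h1]
    congr 1
    ext ω
    simp only [mem_inter_iff, mem_preimage, mem_prod]
    tauto
  rw [← lintegral_map (f := h) hh (hY'.prodMk hZ), hmeas, Measure.lintegral_compProd hh,
    lintegral_map (hh.lintegral_kernel_prod_right') hY']

end ConditionalLaw

/-! ### The probability of leaving a neighbourhood of the path -/

section Exit

variable {Ω E : Type*} [MeasurableSpace Ω] [NormedAddCommGroup E] [MeasurableSpace E]
  [BorelSpace E]

/-- The event that the sequence `D` stays in the ball of radius `δ` up to time `n`. -/
def stayEvent (D : ℕ → Ω → E) (δ : ℝ) (n : ℕ) : Set Ω := {ω | ∀ k ≤ n, ‖D k ω‖ < δ}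

omit [MeasurableSpace Ω] in
lemma measurableSet_stayEvent {m : MeasurableSpace Ω} {D : ℕ → Ω → E} {δ : ℝ} {n : ℕ}
    (hD : ∀ k ≤ n, Measurable[m] (D k)) : MeasurableSet[m] (stayEvent D δ n) := by
  have : stayEvent D δ n = ⋂ k, ⋂ (_ : k ≤ n), {ω | ‖D k ω‖ < δ} := by
    ext ω
    simp [stayEvent]
  rw [this]
  exact MeasurableSet.iInter fun k => MeasurableSet.iInter fun hk =>
    measurableSet_lt (hD k hk).norm measurable_const

omit [MeasurableSpace Ω] [MeasurableSpace E] [BorelSpace E] in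
lemma stayEvent_succ_subset (D : ℕ → Ω → E) (δ : ℝ) (n : ℕ) :
    stayEvent D δ (n + 1) ⊆ stayEvent D δ n := fun _ hω k hk => hω k (hk.trans n.le_succ)

/-- A discrete Gronwall inequality for a Lyapunov function `f` along a process killed when it
leaves a ball, `c` being a lower bound of `f` outside of the ball. No maximal inequality is
needed, since the mass killed at each step is accounted for by the value of `f` on exit. -/
lemma mul_measure_compl_stayEvent_le (P : Measure Ω) [IsProbabilityMeasure P] {D : ℕ → Ω → E}
    {δ : ℝ} (hδ : 0 < δ) {N : ℕ} (hD : ∀ k ≤ N, Measurable (D k)) {f : E → ℝ≥0∞}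
    (hf : Measurable f) (hf0 : f 0 = 0) {c : ℝ≥0∞} (hc : ∀ a, δ ≤ ‖a‖ → c ≤ f a)
    (hD0 : ∀ᵐ ω ∂P, D 0 ω = 0) {a ρ : ℝ≥0∞} (ha : 1 ≤ a)
    (hstep : ∀ n < N, ∫⁻ ω in stayEvent D δ n, f (D (n + 1) ω) ∂P ≤
      ∫⁻ ω in stayEvent D δ n, (a * f (D n ω) + ρ) ∂P) :
    c * P (stayEvent D δ N)ᶜ ≤ N * a ^ N * ρ := by
  have key : ∀ n ≤ N, (∫⁻ ω in stayEvent D δ n, f (D n ω) ∂P) + c * P (stayEvent D δ n)ᶜ ≤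
      n * a ^ n * ρ := by
    intro n
    induction n with
    | zero =>
      intro _
      have h1 : ∫⁻ ω in stayEvent D δ 0, f (D 0 ω) ∂P = 0 := by
        rw [lintegral_congr_ae (g := fun _ => 0)
          (ae_restrict_of_ae (hD0.mono fun ω hω => by simp [hω, hf0]))]
        simp
      have h2 : P (stayEvent D δ 0)ᶜ = 0 := by
        have : ∀ᵐ ω ∂P, ω ∈ stayEvent D δ 0 := by
          filter_upwards [hD0] with ω hω k hk
          rw [Nat.le_zero.1 hk, hω, norm_zero]
          exact hδ
        exact this
      simp [h1, h2]
    | succ n ih =>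
      intro hn
      have hn' : n < N := hn
      set A := stayEvent D δ n with hA
      set B := stayEvent D δ (n + 1) with hB
      have hAm : MeasurableSet A := measurableSet_stayEvent fun k hk => hD k (by omega)
      have hBm : MeasurableSet B := measurableSet_stayEvent fun k hk => hD k (by omega)
      have hBA : B ⊆ A := stayEvent_succ_subset D δ n
      have hexit : c * P (A \ B) ≤ ∫⁻ ω in A \ B, f (D (n + 1) ω) ∂P := by
        rw [← setLIntegral_const]
        refine setLIntegral_mono' (hAm.diff hBm) fun ω hω => hc _ ?_
        by_contra hlt
        refine hω.2 fun k hk => ?_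
        rcases Nat.le_succ_iff.1 hk with hk | hk
        · exact hω.1 k hk
        · rw [hk]
          exact not_le.1 hlt
      have hcompl : P Bᶜ ≤ P (A \ B) + P Aᶜ := by
        refine (measure_mono fun ω hω => ?_).trans (measure_union_le _ _)
        by_cases h : ω ∈ A
        · exact Or.inl ⟨h, hω⟩
        · exact Or.inr h
      calc (∫⁻ ω in B, f (D (n + 1) ω) ∂P) + c * P Bᶜ
          ≤ (∫⁻ ω in B, f (D (n + 1) ω) ∂P) + (c * P (A \ B) + c * P Aᶜ) := by
            rw [← mul_add]
            gcongr
        _ ≤ ((∫⁻ ω in B, f (D (n + 1) ω) ∂P) + ∫⁻ ω in A \ B, f (D (n + 1) ω) ∂P)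
              + c * P Aᶜ := by
            rw [add_assoc]
            gcongr
        _ = (∫⁻ ω in A, f (D (n + 1) ω) ∂P) + c * P Aᶜ := by
            rw [← lintegral_inter_add_sdiff _ A hBm, inter_eq_right.2 hBA]
        _ ≤ (∫⁻ ω in A, (a * f (D n ω) + ρ) ∂P) + c * P Aᶜ := by
            exact add_le_add (hstep n hn') le_rfl
        _ ≤ (a * (∫⁻ ω in A, f (D n ω) ∂P) + ρ) + a * (c * P Aᶜ) := by
            rw [lintegral_add_right _ measurable_const, lintegral_const_mul (f := fun ω => f (D n ω)) a
              (hf.comp (hD n hn'.le)), setLIntegral_const]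
            exact add_le_add (add_le_add le_rfl (mul_le_of_le_one_right' prob_le_one))
              (le_mul_of_one_le_left' ha)
        _ = a * ((∫⁻ ω in A, f (D n ω) ∂P) + c * P Aᶜ) + ρ := by ring
        _ ≤ a * (n * a ^ n * ρ) + a ^ (n + 1) * ρ := by
            gcongr
            · exact ih hn'.le
            · exact le_mul_of_one_le_left' (one_le_pow₀ ha)
        _ = ((n + 1 : ℕ) : ℝ≥0∞) * a ^ (n + 1) * ρ := by
            push_cast
            ring
  exact le_trans le_add_self (key N le_rfl)

end Exit

section Walk

variable {d : ℕ}

/-- The conditioned jump laws at a fixed time form a kernel. -/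
lemma exists_kernel_condJump {μ : Kernel (Rd d) (Rd d)} [IsMarkovKernel μ]
    {p : ℕ → Rd d → Rd d → ℝ} {ε : ℝ} (hp : IsTransitionDensity μ ε p) (xT : Rd d) (T t : ℝ) :
    ∃ κ : Kernel (Rd d) (Rd d), IsSFiniteKernel κ ∧ ∀ x, κ x = condJump μ p xT T ε x t := by
  by_cases h : stepsLeft T ε t ≤ 1
  · refine ⟨Kernel.deterministic (fun x => ε⁻¹ • (xT - x)) (by fun_prop), inferInstance,
      fun x => ?_⟩
    rw [Kernel.deterministic_apply, condJump, if_pos h]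
  · have hm1 : Measurable (Function.uncurry (p (stepsLeft T ε t - 1))) :=
      hp.measurable _ (by omega)
    have hm2 : Measurable (Function.uncurry (p (stepsLeft T ε t))) := hp.measurable _ (by omega)
    set g : Rd d → Rd d → ℝ≥0∞ := fun x z => ENNReal.ofReal
        (p (stepsLeft T ε t - 1) (x + ε • z) xT / p (stepsLeft T ε t) x xT) with hg
    have hm : Measurable (Function.uncurry g) := by
      refine Measurable.ennreal_ofReal (Measurable.div ?_ ?_)
      · exact hm1.comp (g := Function.uncurry (p (stepsLeft T ε t - 1)))
          (f := fun q : Rd d × Rd d => (q.1 + ε • q.2, xT)) (by fun_prop)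
      · exact hm2.comp (g := Function.uncurry (p (stepsLeft T ε t)))
          (f := fun q : Rd d × Rd d => (q.1, xT)) (by fun_prop)
    refine ⟨Kernel.withDensity μ g,
      Kernel.isSFiniteKernel_withDensity_of_isFiniteKernel μ fun _ _ => ENNReal.ofReal_ne_top,
      fun x => ?_⟩
    rw [Kernel.withDensity_apply μ hm, condJump, if_neg h]

variable {Ω : Type*} [MeasurableSpace Ω] {P : Measure Ω} {T ε : ℝ} {x₀ : Rd d}
  {ν : Rd d → ℝ → Measure (Rd d)} {X : ℝ → Ω → Rd d} {Z : ℕ → Ω → Rd d}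

lemma mul_mem_Icc_of_le_floor (hε : 0 < ε) {n : ℕ} (hT : 0 ≤ T) (hn : n ≤ ⌊T / ε⌋₊) :
    (n : ℝ) * ε ∈ Icc 0 T := by
  refine ⟨by positivity, ?_⟩
  rw [← le_div_iff₀ hε]
  exact (Nat.le_floor_iff (by positivity)).1 hn

lemma IsJumpProcess.apply_mul (hX : IsJumpProcess P T ε x₀ ν X Z) (hε : 0 < ε) (hT : 0 ≤ T)
    {n : ℕ} (hn : n ≤ ⌊T / ε⌋₊) (ω : Ω) :
    X (n * ε) ω = X 0 ω + ε • ∑ k ∈ Finset.range n, Z k ω := by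
  rw [hX.path _ (mul_mem_Icc_of_le_floor hε hT hn), mul_div_cancel_right₀ _ hε.ne',
    Nat.floor_natCast]

lemma IsJumpProcess.measurable_apply_mul (hX : IsJumpProcess P T ε x₀ ν X Z) (hε : 0 < ε)
    (hT : 0 ≤ T) {n : ℕ} (hn : n ≤ ⌊T / ε⌋₊) : Measurable (X (n * ε)) := by
  have : X (n * ε) = fun ω => X 0 ω + ε • ∑ k ∈ Finset.range n, Z k ω :=
    funext (hX.apply_mul hε hT hn)
  rw [this]
  have h1 := hX.measurable_init
  have h2 := hX.measurable_jump
  exact h1.add ((Finset.measurable_fun_sum _ fun k _ => h2 k).const_smul ε)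

lemma IsJumpProcess.apply_succ_mul (hX : IsJumpProcess P T ε x₀ ν X Z) (hε : 0 < ε)
    (hT : 0 ≤ T) {n : ℕ} (hn : n < ⌊T / ε⌋₊) (ω : Ω) :
    X ((n + 1 : ℕ) * ε) ω = X (n * ε) ω + ε • Z n ω := by
  rw [hX.apply_mul hε hT hn, hX.apply_mul hε hT hn.le, Finset.sum_range_succ, smul_add, add_assoc]

/-- The process is constant between two consecutive multiples of `ε`. -/
lemma IsJumpProcess.apply_eq_floor (hX : IsJumpProcess P T ε x₀ ν X Z) (hε : 0 < ε)
    {t : ℝ} (ht : t ∈ Icc 0 T) (ω : Ω) : X t ω = X (⌊t / ε⌋₊ * ε) ω := by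
  rw [hX.path t ht, hX.apply_mul hε (ht.1.trans ht.2)]
  exact Nat.floor_le_floor (by gcongr; exact ht.2)

/-- The σ-algebra generated by `X 0, X ε, …, X (n ε)`. -/
abbrev history (X : ℝ → Ω → Rd d) (ε : ℝ) (n : ℕ) : MeasurableSpace Ω :=
  ⨆ k ∈ Finset.range (n + 1), MeasurableSpace.comap (X (k * ε)) inferInstance

/-- A one-step bound, pointwise in the starting point, on the expectation of `f` of the deviation
from a path `φ` turns into a bound in mean along the jump process, before it leaves the
`δ`-neighbourhood of `φ`. -/
lemma IsJumpProcess.setLIntegral_step [IsProbabilityMeasure P]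
    (hX : IsJumpProcess P T ε x₀ ν X Z) (hε : 0 < ε) (hT : 0 ≤ T) {n : ℕ} (hn : n < ⌊T / ε⌋₊)
    {κ : Kernel (Rd d) (Rd d)} [IsSFiniteKernel κ] (hκ : ∀ x, κ x = ν x (n * ε))
    (φ : ℝ → Rd d) {δ : ℝ} {f : Rd d → ℝ≥0∞} (hf : Measurable f) {a ρ : ℝ≥0∞}
    (hstep : ∀ x, ‖x - φ (n * ε)‖ < δ → IsProbabilityMeasure (ν x (n * ε)) →
      ∫⁻ z, f (x - φ ((n + 1 : ℕ) * ε) + ε • z) ∂(ν x (n * ε)) ≤ a * f (x - φ (n * ε)) + ρ) :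
    ∫⁻ ω in stayEvent (fun k ω => X (k * ε) ω - φ (k * ε)) δ n,
        f (X ((n + 1 : ℕ) * ε) ω - φ ((n + 1 : ℕ) * ε)) ∂P ≤
      ∫⁻ ω in stayEvent (fun k ω => X (k * ε) ω - φ (k * ε)) δ n,
        (a * f (X (n * ε) ω - φ (n * ε)) + ρ) ∂P := by
  have hmle : history X ε n ≤ ‹MeasurableSpace Ω› := by
    refine iSup₂_le fun k hk => (hX.measurable_apply_mul hε hT ?_).comap_le
    have := Finset.mem_range.1 hk
    omega
  have hXm : ∀ k ≤ n, Measurable[history X ε n] (X (k * ε)) := fun k hk =>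
    (comap_measurable (X (k * ε))).mono (le_iSup₂_of_le k (Finset.mem_range.2 (by omega)) le_rfl)
      le_rfl
  set A := stayEvent (fun k ω => X (k * ε) ω - φ (k * ε)) δ n with hA
  have hAm : MeasurableSet[history X ε n] A :=
    measurableSet_stayEvent fun k hk => (hXm k hk).sub_const (φ (k * ε))
  have hlaw : ∀ D, MeasurableSet D → P[(Z n ⁻¹' D).indicator (fun _ => (1 : ℝ)) | history X ε n]
      =ᵐ[P] fun ω => (κ (X (n * ε) ω)).real D := by
    intro D hD
    simp only [hκ]
    exact hX.jump_law n hn D hD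
  have hprob := ae_isProbabilityMeasure_of_condExp hmle hlaw
  have hh : Measurable fun q : Rd d × Rd d => f (q.1 - φ ((n + 1 : ℕ) * ε) + ε • q.2) := by
    refine hf.comp ?_
    fun_prop
  have h1 := setLIntegral_eq_of_condExp hmle (hXm n le_rfl) (hX.measurable_jump n) hlaw hAm hh
  have h2 : ∀ ω, f (X ((n + 1 : ℕ) * ε) ω - φ ((n + 1 : ℕ) * ε)) =
      f (X (n * ε) ω - φ ((n + 1 : ℕ) * ε) + ε • Z n ω) := fun ω => by
    rw [hX.apply_succ_mul hε hT hn ω]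
    congr 1
    abel
  simp only [h2]
  rw [h1]
  refine lintegral_mono_ae ?_
  filter_upwards [ae_restrict_of_ae hprob, ae_restrict_mem (hmle _ hAm)] with ω h3 h4
  rw [hκ] at h3 ⊢
  exact hstep _ (h4 n le_rfl) h3

end Walk

end NPPD

/-! ### Convergence of the conditioned walk to the optimal path -/

theorem mainTheorem2 {d : ℕ}
    (μ : Kernel (NPPD.Rd d) (NPPD.Rd d)) [IsMarkovKernel μ]
    (x₀ xT : NPPD.Rd d) (T : ℝ) (hT : 0 < T)
    -- the conditions of the large deviation principle and smoothness of the Hamiltonian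
    (hLDP : NPPD.LDPConditions μ)
    (k : ℕ) (hk : 1 ≤ k)
    (hH : ContDiff ℝ ((k + 1 : ℕ) : WithTop ℕ∞)
      (fun q : NPPD.Rd d × NPPD.Rd d => (NPPD.hamiltonian μ q.1 q.2).toReal))
    -- the optimal path, a proper subarc of another optimal path
    (φ : ℝ → NPPD.Rd d) (hφ : NPPD.IsNOP μ xT T x₀ φ) (hsub : NPPD.IsProperSubarc μ T φ)
    -- the transition densities `p ε n x y` of the walk
    (p : ℝ → ℕ → NPPD.Rd d → NPPD.Rd d → ℝ)
    (hp : ∀ᶠ ε in 𝓝[>] (0 : ℝ), NPPD.IsTransitionDensity μ ε (p ε))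
    -- smoothness of `S(xT, T - t | x)`; continuity and positivity of the densities
    (hreg : ∀ Ts ∈ Ioo 0 T, ∃ δ₀ > 0,
      ContDiffOn ℝ 2
        (fun q : NPPD.Rd d × ℝ => (NPPD.quasiPotential μ xT (T - q.2) q.1).toReal)
        (NPPD.tube φ δ₀ Ts ×ˢ Icc 0 Ts) ∧
      ∀ᶠ ε in 𝓝[>] (0 : ℝ),
        (∀ t ∈ Icc 0 Ts, ∀ x, Continuous (p ε (NPPD.stepsLeft T ε t) x) ∧
          0 < p ε (NPPD.stepsLeft T ε t) x xT) ∧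
        TendstoUniformlyOn
          (fun (r : ℝ) (q : NPPD.Rd d × ℝ) =>
            (NPPD.transitionLaw μ T ε q.2 q.1).real (Metric.ball xT r)
              / (volume : Measure (NPPD.Rd d)).real (Metric.ball xT r))
          (fun q => p ε (NPPD.stepsLeft T ε q.2) q.1 xT)
          (𝓝[>] 0) (NPPD.tube φ δ₀ Ts ×ˢ Icc 0 Ts))
    -- moment bounds and uniform convergence of the drift for the conditioned jump laws
    (hdrift : ∀ Ts ∈ Ioo 0 T, ∃ δ₀ > 0,
      (∃ G₃ : ℝ≥0, ∀ᶠ ε in 𝓝[>] (0 : ℝ), ∀ x ∈ NPPD.tube φ δ₀ Ts, ∀ t ∈ Icc 0 Ts,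
        ∫⁻ z, ‖z‖ₑ ∂(NPPD.condJump μ (p ε) xT T ε x t) ≤ G₃) ∧
      TendstoUniformlyOn
        (fun (ε : ℝ) (q : NPPD.Rd d × ℝ) => NPPD.condDrift μ (p ε) xT T ε q.1 q.2)
        (fun q => NPPD.limitDrift μ xT T q.1 q.2)
        (𝓝[>] 0) (NPPD.tube φ δ₀ Ts ×ˢ Icc 0 Ts) ∧
      ∃ κ₂ ∈ Ioc (0 : ℝ) 1, ∃ G₄ : ℝ≥0, ∀ᶠ ε in 𝓝[>] (0 : ℝ),
        ∀ x ∈ NPPD.tube φ δ₀ Ts, ∀ t ∈ Icc 0 Ts,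
          ∫⁻ z, ‖z - NPPD.condDrift μ (p ε) xT T ε x t‖ₑ ^ (1 + κ₂)
            ∂(NPPD.condJump μ (p ε) xT T ε x t) ≤ G₄)
    -- the conditioned process started at `x₀`, for every small `ε`
    {Ω : ℝ → Type*} [∀ ε, MeasurableSpace (Ω ε)]
    (P : ∀ ε, Measure (Ω ε)) [∀ ε, IsProbabilityMeasure (P ε)]
    (X : ∀ ε, ℝ → Ω ε → NPPD.Rd d) (Z : ∀ ε, ℕ → Ω ε → NPPD.Rd d)
    (hX : ∀ᶠ ε in 𝓝[>] (0 : ℝ),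
      NPPD.IsJumpProcess (P ε) T ε x₀ (NPPD.condJump μ (p ε) xT T ε) (X ε) (Z ε)) :
    ∀ Ts ∈ Ioo 0 T, ∃ δ₀ > 0, ∀ δ ∈ Ioo 0 δ₀,
      Tendsto
        (fun ε => P ε {ω | ENNReal.ofReal δ < ⨆ t ∈ Icc 0 Ts, ‖X ε t ω - φ t‖ₑ})
        (𝓝[>] 0) (𝓝 0) := by
  intro Ts hTs
  have hT' : 0 ≤ T := hT.le
  have hTs0 : 0 ≤ Ts := hTs.1.le
  have hH2 : ContDiff ℝ 2
      (fun q : NPPD.Rd d × NPPD.Rd d => (NPPD.hamiltonian μ q.1 q.2).toReal) :=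
    hH.of_le (by exact_mod_cast Nat.succ_le_succ hk)
  obtain ⟨δ₁, hδ₁, hV, -⟩ := hreg Ts hTs
  obtain ⟨δ₂, hδ₂, ⟨G₃, hG₃⟩, hunif, κ₂, hκ₂, G₄, hG₄⟩ := hdrift Ts hTs
  have hφc : ContinuousOn φ (Icc 0 Ts) := by
    have := (NPPD.absolutelyContinuous_of_action hφ.finite).continuousOn
    rw [uIcc_of_le hT'] at this
    exact this.mono (Icc_subset_Icc_right hTs.2.le)
  obtain ⟨K, r, hr, hK⟩ := NPPD.exists_lipschitz_near_path hδ₁ hφc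
    (NPPD.contDiffOn_limitDrift hH2 (NPPD.isOpen_tube φ δ₁ Ts) hTs.1 hV)
  refine ⟨min δ₂ r, lt_min hδ₂ hr, fun δ hδ => ?_⟩
  have hδ0 : 0 < δ / 2 := half_pos hδ.1
  have hδ2 : δ / 2 < δ₂ := by linarith [hδ.1, hδ.2, min_le_left δ₂ r]
  have hδr : δ / 2 < r := by linarith [hδ.1, hδ.2, min_le_right δ₂ r]
  set c := NPPD.softNorm (δ / 2) with hc
  have hc0 : 0 < c := NPPD.softNorm_pos hδ0.ne'
  obtain ⟨h₁, hh₁, hφu⟩ := Metric.uniformContinuousOn_iff.1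
    (isCompact_Icc.uniformContinuousOn_of_continuous hφc) (δ / 2) hδ0
  rw [ENNReal.tendsto_nhds_zero]
  intro e he
  rcases eq_or_ne e ∞ with rfl | he'
  · exact Filter.Eventually.of_forall fun _ => le_top
  have he0 : 0 < e.toReal := ENNReal.toReal_pos he.ne' he'
  -- the allowed drift error, chosen so that the Gronwall bound for the exit probability is `e`
  set η := c * e.toReal / (3 * Ts * Real.exp (2 * K * Ts)) with hη
  have hη0 : 0 < η := by
    have := hTs.1
    positivity
  obtain ⟨h₀, hh₀, hφd⟩ := hφ.exists_norm_sub_limitDrift_le hLDP hH2 hTs hδ₁ hV hη0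
  have hid : Tendsto (fun ε : ℝ => ε) (𝓝[>] 0) (𝓝 0) :=
    tendsto_nhdsWithin_of_tendsto_nhds tendsto_id
  have hsmall : ∀ᶠ ε in 𝓝[>] (0 : ℝ), 2 * ε ^ κ₂ * G₄ < η := by
    have h1 : Tendsto (fun ε : ℝ => 2 * ε ^ κ₂ * (G₄ : ℝ)) (𝓝[>] 0) (𝓝 (2 * 0 ^ κ₂ * G₄)) :=
      ((hid.rpow_const (Or.inr hκ₂.1.le)).const_mul 2).mul_const _
    rw [Real.zero_rpow hκ₂.1.ne', mul_zero, zero_mul] at h1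
    exact h1.eventually_lt_const hη0
  filter_upwards [hp, hX, hG₃, hG₄, Metric.tendstoUniformlyOn_iff.1 hunif η hη0, hsmall,
    hid.eventually_lt_const hh₀, hid.eventually_lt_const hh₁, self_mem_nhdsWithin]
    with ε hp hX hG₃ hG₄ hunif hsmall hεh₀ hεh₁ (hε : 0 < ε)
  set N := ⌊Ts / ε⌋₊ with hN
  set D : ℕ → Ω ε → NPPD.Rd d := fun k ω => X ε (k * ε) ω - φ (k * ε) with hD
  set f : NPPD.Rd d → ℝ≥0∞ := fun a => ENNReal.ofReal (NPPD.softNorm a) with hf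
  have hNT : N ≤ ⌊T / ε⌋₊ := Nat.floor_le_floor (by gcongr; exact hTs.2.le)
  have hgrid : ∀ n ≤ N, (n : ℝ) * ε ∈ Icc 0 Ts := fun n hn =>
    NPPD.mul_mem_Icc_of_le_floor hε hTs0 hn
  have hfm : Measurable f := NPPD.continuous_softNorm.measurable.ennreal_ofReal
  have hexit : ENNReal.ofReal c * P ε (NPPD.stayEvent D (δ / 2) N)ᶜ ≤
      N * ENNReal.ofReal ((1 + ε * K) ^ 2) ^ N * ENNReal.ofReal (3 * η * ε) := by
    refine NPPD.mul_measure_compl_stayEvent_le (P ε) hδ0 (f := f) (fun k hk => ?_) hfm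
      (by simp [hf]) (fun a ha => ?_) ?_ ?_ (fun n hn => ?_)
    · exact (hX.measurable_apply_mul hε hT' (hk.trans hNT)).sub_const _
    · refine ENNReal.ofReal_le_ofReal (NPPD.softNorm_le_of_norm_le ?_)
      rwa [Real.norm_of_nonneg hδ0.le]
    · filter_upwards [hX.init] with ω hω
      simp [hD, hω, hφ.start]
    · rw [ENNReal.one_le_ofReal]
      exact one_le_pow₀ (by linarith [mul_nonneg hε.le K.coe_nonneg])
    · obtain ⟨κ, hκ, hκν⟩ := NPPD.exists_kernel_condJump hp xT T (n * ε)
      refine hX.setLIntegral_step hε hT' (hn.trans_le hNT) hκν φ hfm (fun x hx hprob => ?_)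
      have ht := hgrid n hn.le
      have ht' := hgrid (n + 1) hn
      have hstep : ((n + 1 : ℕ) : ℝ) * ε - n * ε = ε := by push_cast; ring
      set t := (n : ℝ) * ε with htdef
      set t' := ((n + 1 : ℕ) : ℝ) * ε with ht'def
      have hxt : x ∈ NPPD.tube φ δ₂ Ts := NPPD.mem_tube ht (hx.trans hδ2)
      have hmom := NPPD.lintegral_softNorm_add_smul_le hκ₂ (NPPD.condJump μ (p ε) xT T ε x t)
        (ne_top_of_le_ne_top ENNReal.coe_ne_top (hG₃ x hxt t ht)) (hG₄ x hxt t ht)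
        (x - φ t') hε.le
      refine hmom.trans ?_
      set b := ∫ w, w ∂(NPPD.condJump μ (p ε) xT T ε x t) with hb
      have hb1 : ‖b - NPPD.limitDrift μ xT T x t‖ ≤ η := by
        have := hunif (x, t) ⟨hxt, ht⟩
        rw [dist_comm, dist_eq_norm] at this
        exact this.le
      have hb2 := hK t ht x (hx.trans hδr)
      have hb3 := hφd t ht t' ht' (by linarith) (by linarith)
      rw [hstep] at hb3
      -- the mean of the next deviation: drift error, Lipschitz error and time discretization
      have hnorm : ‖x - φ t' + ε • b‖ ≤ (1 + ε * K) * ‖x - φ t‖ + 2 * η * ε := by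
        have h1 : x - φ t' + ε • b = (x - φ t) + ε • (b - NPPD.limitDrift μ xT T x t) +
            ε • (NPPD.limitDrift μ xT T x t - NPPD.limitDrift μ xT T (φ t) t) -
            (φ t' - φ t - ε • NPPD.limitDrift μ xT T (φ t) t) := by
          simp only [smul_sub]
          abel
        rw [h1]
        refine (norm_sub_le _ _).trans ?_
        have h2 := norm_add₃_le (a := x - φ t) (b := ε • (b - NPPD.limitDrift μ xT T x t))
          (c := ε • (NPPD.limitDrift μ xT T x t - NPPD.limitDrift μ xT T (φ t) t))
        rw [norm_smul, norm_smul, Real.norm_of_nonneg hε.le] at h2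
        have h3 := mul_le_mul_of_nonneg_left hb1 hε.le
        have h4 := mul_le_mul_of_nonneg_left hb2 hε.le
        linarith
      have hsoft := NPPD.softNorm_le_of_norm_le_add (mul_nonneg hε.le K.coe_nonneg)
        (by positivity) hnorm
      have hpow : 2 * ε ^ (1 + κ₂) * G₄ ≤ η * ε := by
        rw [Real.rpow_add hε, Real.rpow_one]
        have := mul_le_mul_of_nonneg_right hsmall.le hε.le
        linarith
      rw [hf, ← ENNReal.ofReal_mul (by positivity), ← ENNReal.ofReal_add
        (mul_nonneg (by positivity) (NPPD.softNorm_nonneg _)) (by positivity)]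
      exact ENNReal.ofReal_le_ofReal (by linarith)
  have hNε : N * ε ≤ Ts := (hgrid N le_rfl).2
  have hbound : N * ENNReal.ofReal ((1 + ε * K) ^ 2) ^ N * ENNReal.ofReal (3 * η * ε) ≤
      ENNReal.ofReal c * e := by
    have h1 : ((1 + ε * K) ^ 2) ^ N ≤ Real.exp (2 * K * Ts) := by
      have h2 : 1 + ε * K ≤ Real.exp (ε * K) := by
        rw [add_comm]
        exact Real.add_one_le_exp _
      rw [← pow_mul]
      refine (pow_le_pow_left₀ (by positivity) h2 _).trans ?_
      rw [← Real.exp_nat_mul, Real.exp_le_exp]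
      push_cast
      have := mul_le_mul_of_nonneg_left hNε (mul_nonneg zero_le_two K.coe_nonneg)
      linarith
    have h3 : (N : ℝ) * ((1 + ε * K) ^ 2) ^ N * (3 * η * ε) ≤ c * e.toReal := by
      calc (N : ℝ) * ((1 + ε * K) ^ 2) ^ N * (3 * η * ε)
          = (N * ε) * ((1 + ε * K) ^ 2) ^ N * (3 * η) := by ring
        _ ≤ Ts * Real.exp (2 * K * Ts) * (3 * η) := by gcongr
        _ = c * e.toReal := by
          rw [hη]
          have := hTs.1.ne'
          have := (Real.exp_pos (2 * K * Ts)).ne'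
          field_simp
    rw [← ENNReal.ofReal_natCast, ← ENNReal.ofReal_pow (by positivity),
      ← ENNReal.ofReal_mul (by positivity), ← ENNReal.ofReal_mul (by positivity)]
    refine (ENNReal.ofReal_le_ofReal h3).trans (le_of_eq ?_)
    rw [ENNReal.ofReal_mul hc0.le, ENNReal.ofReal_toReal he']
  have hP : P ε (NPPD.stayEvent D (δ / 2) N)ᶜ ≤ e :=
    (ENNReal.mul_le_mul_iff_right (ENNReal.ofReal_pos.2 hc0).ne' ENNReal.ofReal_ne_top).1
      (hexit.trans hbound)
  refine (measure_mono fun ω hω hstay => ?_).trans hP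
  -- between grid points the process is constant, and the path moves by less than `δ / 2`
  have hω' : ENNReal.ofReal δ < ⨆ t ∈ Icc 0 Ts, ‖X ε t ω - φ t‖ₑ := hω
  refine absurd hω' (not_lt.2 (iSup₂_le fun t ht => ?_))
  have htT : t ∈ Icc 0 T := ⟨ht.1, ht.2.trans hTs.2.le⟩
  have hn : ⌊t / ε⌋₊ ≤ N := Nat.floor_le_floor (by gcongr; exact ht.2)
  have h1 := hstay _ hn
  have h2 : (⌊t / ε⌋₊ : ℝ) * ε ≤ t := by
    rw [← le_div_iff₀ hε]
    exact Nat.floor_le (div_nonneg ht.1 hε.le)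
  have h3 : t < (⌊t / ε⌋₊ + 1 : ℝ) * ε := by
    rw [← div_lt_iff₀ hε]
    exact Nat.lt_floor_add_one _
  have h4 := hφu _ (hgrid _ hn) t ht (by
    rw [Real.dist_eq, abs_sub_comm, abs_of_nonneg (sub_nonneg.2 h2)]
    linarith)
  rw [dist_eq_norm] at h4
  rw [hX.apply_eq_floor hε htT, ← ofReal_norm]
  refine ENNReal.ofReal_le_ofReal ?_
  have h5 := norm_add_le (D ⌊t / ε⌋₊ ω) (φ (⌊t / ε⌋₊ * ε) - φ t)
  rw [hD] at h1 h5
  simp only [sub_add_sub_cancel] at h1 h5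
  linarith
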